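/- Let $\nu\ge 1$ be an integer and let $\mathcal D_\nu$ be the complex Lie algebra (under the commutator) of all differential operators on $\mathbb C[t_1^{\pm1},\dots,t_\nu^{\pm1}]$. With $D_i=t_i\frac{\partial}{\partial t_i}$, it has the basis $t^{m}D^{n}=t_1^{m_1}\cdots t_\nu^{m_\nu}D_1^{n_1}\cdots D_\nu^{n_\nu}$ for $m=(m_1,\dots,m_\nu)\in\mathbb Z^\nu$ and $n=(n_1,\dots,n_\nu)\in\mathbb Z_{\ge 0}^\nu$. Let $\mathfrak h_\nu=\operatorname{span}_{\mathbb C}\{D_1,\dots,D_\nu\}$, an abelian Lie subalgebra of $\mathcal D_\nu$. For $\Lambda=(\lambda_1,\dots,\lambda_\nu)\in(\mathbb C^*)^\nu$ and $\epsilon\in\{0,1\}$, let $\Omega(\Lambda,\epsilon)$ be the $\mathcal D_\nu$-module with underlying space $\mathbb C[x_1,\dots,x_\nu]$ and action $$t^{m}D^{n}\cdot f(x_1,\dots,x_\nu)=\beta^{\,1-\sum_{i=1}^{\nu} n_i}\;\lambda_1^{m_1}\cdots\lambda_\nu^{m_\nu}\;\prod_{j=1}^{\nu}(x_j-\epsilon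 m_j)^{n_j}\; f(x_1-m_1,\dots,x_\nu-m_\nu),\qquad \beta=(-1)^{1-\epsilon}.$$ **Theorem.** Let $M$ be a $\mathcal D_\nu$-module whose restriction to the universal enveloping algebra $U(\mathfrak h_\nu)$ is a free $U(\mathfrak h_\nu)$-module of rank $1$. Then there are $\Lambda\in(\mathbb C^*)^\nu$ and $\epsilon\in\{0,1\}$ such that $M\cong\Omega(\Lambda,\epsilon)$ as $\mathcal D_\nu$-modules. -/

import Mathlib

noncomputable section

attribute [local instance] LieRing.ofAssociativeRing

namespace DiffOpModule

variable {ν : ℕ}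

/-- The Laurent polynomial algebra `ℂ[t₁^{±1}, …, t_ν^{±1}]`. -/
abbrev Laurent (ν : ℕ) : Type := AddMonoidAlgebra ℂ (Fin ν → ℤ)

/-- The Laurent monomial `t^m`. -/
def tpow (m : Fin ν → ℤ) : Laurent ν := AddMonoidAlgebra.single m 1

/-- The operator `D_i = t_i d/dt_i`, i.e. `D_i t^k = k_i t^k`. -/
def euler (i : Fin ν) : Module.End ℂ (Laurent ν) :=
  (AddMonoidAlgebra.basis (Fin ν → ℤ) ℂ).constr ℂ fun k => (k i : ℂ) • tpow k

/-- The associative algebra of differential operators on the Laurent polynomial algebra: the algebra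
of operators generated by all multiplication operators and the derivations `D₁, …, D_ν`. -/
def diffAlg (ν : ℕ) : Subalgebra ℂ (Module.End ℂ (Laurent ν)) :=
  Algebra.adjoin ℂ
    (Set.range (LinearMap.mulLeft ℂ : Laurent ν → Module.End ℂ (Laurent ν)) ∪ Set.range euler)

/-- The Lie algebra `𝒟_ν` of differential operators; its bracket is the commutator. -/
def DiffLie (ν : ℕ) : Type := diffAlg ν

instance (ν : ℕ) : LieRing (DiffLie ν) := inferInstanceAs (LieRing (diffAlg ν))

instance (ν : ℕ) : LieAlgebra ℂ (DiffLie ν) := inferInstanceAs (LieAlgebra ℂ (diffAlg ν))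

/-- The inclusion of `𝒟_ν` into the operators on the Laurent polynomial algebra. -/
def incl (ν : ℕ) : DiffLie ν →ₗ[ℂ] Module.End ℂ (Laurent ν) := (diffAlg ν).val.toLinearMap

theorem incl_injective : Function.Injective (incl ν) := Subtype.val_injective

theorem incl_lie (a b : DiffLie ν) : incl ν ⁅a, b⁆ = incl ν a * incl ν b - incl ν b * incl ν a :=
  rfl

/-- The operator `t^m D^n = t^m D₁^{n₁} ⋯ D_ν^{n_ν}`. -/
def diffOp (m : Fin ν → ℤ) (n : Fin ν →₀ ℕ) : Module.End ℂ (Laurent ν) :=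
  LinearMap.mulLeft ℂ (tpow m) * (List.ofFn fun i => euler i ^ n i).prod

theorem euler_mem (i : Fin ν) : euler i ∈ diffAlg ν :=
  Algebra.subset_adjoin (Or.inr ⟨i, rfl⟩)

theorem diffOp_mem (m : Fin ν → ℤ) (n : Fin ν →₀ ℕ) : diffOp m n ∈ diffAlg ν := by
  refine mul_mem (Algebra.subset_adjoin (Or.inl ⟨_, rfl⟩)) (list_prod_mem ?_)
  intro x hx
  obtain ⟨i, rfl⟩ := (List.mem_ofFn' _ _).1 hx
  exact pow_mem (euler_mem i) _

/-- `t^m D^n` as an element of `𝒟_ν`. -/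
def tD (m : Fin ν → ℤ) (n : Fin ν →₀ ℕ) : DiffLie ν := ⟨diffOp m n, diffOp_mem m n⟩

/-- `D_i` as an element of `𝒟_ν`. -/
def eulerD (i : Fin ν) : DiffLie ν := ⟨euler i, euler_mem i⟩

/-! ### The monomials `t^m D^n` form a basis of `𝒟_ν` -/

theorem euler_tpow (i : Fin ν) (k : Fin ν → ℤ) : euler i (tpow k) = (k i : ℂ) • tpow k := by
  have := (AddMonoidAlgebra.basis (Fin ν → ℤ) ℂ).constr_basis ℂ
    (fun k => (k i : ℂ) • (tpow k : Laurent ν)) k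
  simpa [euler, tpow] using this

theorem tpow_mul (m k : Fin ν → ℤ) : tpow m * tpow k = tpow (m + k) := by
  simp [tpow, AddMonoidAlgebra.single_mul_single]

theorem end_ext {V : Type*} [AddCommMonoid V] [Module ℂ V] {a b : Laurent ν →ₗ[ℂ] V}
    (h : ∀ k, a (tpow k) = b (tpow k)) : a = b :=
  (AddMonoidAlgebra.basis (Fin ν → ℤ) ℂ).ext fun k => by simpa [tpow] using h k

theorem tpow_lin : LinearIndependent ℂ (tpow : (Fin ν → ℤ) → Laurent ν) := by
  have := (AddMonoidAlgebra.basis (Fin ν → ℤ) ℂ).linearIndependent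
  convert this using 1
  ext k : 1
  simp [tpow]

/-- The operators `D_i` are derivations. -/
theorem euler_leibniz (i : Fin ν) (a b : Laurent ν) :
    euler i (a * b) = a * euler i b + euler i a * b := by
  have h : (LinearMap.mul ℂ (Laurent ν)).compr₂ (euler i) =
      (LinearMap.mul ℂ (Laurent ν)).compl₂ (euler i) +
        (LinearMap.mul ℂ (Laurent ν)).comp (euler i) := by
    refine end_ext fun k => end_ext fun l => ?_
    simp [euler_tpow, tpow_mul, ← add_smul, add_comm]
  simpa using LinearMap.congr_fun (LinearMap.congr_fun h a) b

/-- The integer point `k` as a complex point. -/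
def pt (k : Fin ν → ℤ) : Fin ν → ℂ := fun i => (k i : ℂ)

/-- The operator `t^m p(D)`, i.e. `t^k ↦ p(k) t^{m+k}`. -/
def symOp (m : Fin ν → ℤ) : MvPolynomial (Fin ν) ℂ →ₗ[ℂ] Module.End ℂ (Laurent ν) :=
  ((AddMonoidAlgebra.basis (Fin ν → ℤ) ℂ).constr ℂ).toLinearMap ∘ₗ
    LinearMap.pi fun k =>
      ((MvPolynomial.aeval (pt k)).toLinearMap : MvPolynomial (Fin ν) ℂ →ₗ[ℂ] ℂ).smulRight
        (tpow (m + k))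

theorem symOp_tpow (m k : Fin ν → ℤ) (p : MvPolynomial (Fin ν) ℂ) :
    symOp m p (tpow k) = MvPolynomial.aeval (pt k) p • tpow (m + k) := by
  exact (AddMonoidAlgebra.basis (Fin ν → ℤ) ℂ).constr_basis ℂ
    (fun k => MvPolynomial.aeval (pt k) p • (tpow (m + k) : Laurent ν)) k

theorem prod_euler_tpow (n : Fin ν → ℕ) (k : Fin ν → ℤ) :
    (List.ofFn fun i => (euler i : Module.End ℂ (Laurent ν)) ^ n i).prod (tpow k) =
      (∏ i, (k i : ℂ) ^ n i) • tpow k := by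
  have hp (i : Fin ν) (a : ℕ) : (euler i ^ a) (tpow k) = ((k i : ℂ) ^ a) • tpow k := by
    induction a with
    | zero => simp
    | succ a ih => rw [pow_succ, Module.End.mul_apply, euler_tpow, map_smul, ih, smul_smul, pow_succ',]
  rw [List.prod_ofFn.symm]
  rw [List.ofFn_eq_map, List.ofFn_eq_map]
  induction List.finRange ν with
  | nil => simp
  | cons i l ih =>
    simp only [List.map_cons, List.prod_cons, Module.End.mul_apply]
    rw [ih, map_smul, hp, smul_smul, mul_comm]

theorem diffOp_eq (m : Fin ν → ℤ) (n : Fin ν →₀ ℕ) :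
    diffOp m n = symOp m (MvPolynomial.monomial n 1) := by
  refine end_ext fun k => ?_
  rw [symOp_tpow, diffOp, Module.End.mul_apply, prod_euler_tpow, map_smul,
    LinearMap.mulLeft_apply, tpow_mul, MvPolynomial.aeval_monomial, Finsupp.prod_fintype _ _ (by simp)]
  simp [pt]

/-- Translation `f(x) ↦ f(x - m)`. -/
def translate (m : Fin ν → ℤ) : MvPolynomial (Fin ν) ℂ →ₐ[ℂ] MvPolynomial (Fin ν) ℂ :=
  MvPolynomial.aeval fun i => MvPolynomial.X i - MvPolynomial.C (m i : ℂ)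

theorem translate_translate (m r : Fin ν → ℤ) (p : MvPolynomial (Fin ν) ℂ) :
    translate m (translate r p) = translate (m + r) p := by
  rw [← AlgHom.comp_apply]
  congr 1
  ext i : 1
  simp [translate]
  ring

theorem symOp_mul (m r : Fin ν → ℤ) (p q : MvPolynomial (Fin ν) ℂ) :
    symOp m p * symOp r q = symOp (m + r) (translate (-r) p * q) := by
  refine end_ext fun k => ?_
  have h : MvPolynomial.aeval (pt (r + k)) p = MvPolynomial.aeval (pt k) (translate (-r) p) := by
    rw [← AlgHom.comp_apply]
    congr 1
    ext i : 1
    simp [translate, pt, add_comm]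
  rw [Module.End.mul_apply, symOp_tpow, map_smul, symOp_tpow, symOp_tpow, map_mul, smul_smul, h,
    mul_comm, add_assoc]

/-- The operator with a given family of symbols. -/
def symb (ν : ℕ) : ((Fin ν → ℤ) →₀ MvPolynomial (Fin ν) ℂ) →ₗ[ℂ] Module.End ℂ (Laurent ν) :=
  Finsupp.lsum ℂ symOp

theorem symb_single (m : Fin ν → ℤ) (p : MvPolynomial (Fin ν) ℂ) :
    symb ν (Finsupp.single m p) = symOp m p := by
  simp [symb]

theorem symb_injective : Function.Injective (symb ν) := by
  rw [← LinearMap.ker_eq_bot, LinearMap.ker_eq_bot']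
  intro F hF
  have key (k m : Fin ν → ℤ) : MvPolynomial.aeval (pt k) (F m) = 0 := by
    have h1 := LinearMap.congr_fun hF (tpow k)
    simp only [symb, Finsupp.lsum_apply, Finsupp.sum, LinearMap.sum_apply, symOp_tpow,
      LinearMap.zero_apply] at h1
    have h2 : LinearIndependent ℂ fun m : Fin ν → ℤ => (tpow (m + k) : Laurent ν) :=
      tpow_lin.comp _ (add_left_injective k)
    by_cases hm : m ∈ F.support
    · exact linearIndependent_iff'.1 h2 F.support _ h1 m hm
    · rw [Finsupp.notMem_support_iff.1 hm, map_zero]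
  ext1 m
  refine MvPolynomial.funext_set (fun _ => Set.range ((↑) : ℤ → ℂ))
    (fun _ => Set.infinite_range_of_injective Int.cast_injective) fun x hx => ?_
  choose k hk using fun i => hx i trivial
  have hx' : pt k = x := funext hk
  simpa [← hx', MvPolynomial.aeval_eq_eval] using key k m

theorem symOp_mem (m : Fin ν → ℤ) (p : MvPolynomial (Fin ν) ℂ) : symOp m p ∈ diffAlg ν := by
  induction p using MvPolynomial.induction_on' with
  | monomial n c =>
    have : MvPolynomial.monomial n c = c • MvPolynomial.monomial n (1 : ℂ) := by
      simp [MvPolynomial.smul_monomial]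
    rw [this, map_smul, ← diffOp_eq]
    exact (diffAlg ν).smul_mem (diffOp_mem m n) c
  | add p q hp hq => rw [map_add]; exact add_mem hp hq

theorem mem_diffAlg_iff (a : Module.End ℂ (Laurent ν)) :
    a ∈ diffAlg ν ↔ a ∈ LinearMap.range (symb ν) := by
  constructor
  · intro ha
    have hone : symOp (0 : Fin ν → ℤ) 1 = 1 := end_ext fun k => by
      rw [symOp_tpow]; simp
    induction ha using Algebra.adjoin_induction with
    | mem x hx =>
      rcases hx with ⟨f, rfl⟩ | ⟨i, rfl⟩
      · induction f using AddMonoidAlgebra.induction_linear with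
        | zero => simp
        | add f g hf hg =>
          have : LinearMap.mulLeft ℂ (f + g) = LinearMap.mulLeft ℂ f + LinearMap.mulLeft ℂ g := by
            ext; simp [add_mul]
          rw [this]; exact add_mem hf hg
        | single m c =>
          refine ⟨Finsupp.single m (MvPolynomial.C c), ?_⟩
          rw [symb_single]
          refine end_ext fun k => ?_
          rw [symOp_tpow]
          simp [tpow, AddMonoidAlgebra.single_mul_single, AddMonoidAlgebra.smul_single]
      · refine ⟨Finsupp.single 0 (MvPolynomial.X i), ?_⟩
        rw [symb_single]
        refine end_ext fun k => ?_
        rw [symOp_tpow, euler_tpow]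
        simp [pt]
    | algebraMap r =>
      refine ⟨r • Finsupp.single 0 1, ?_⟩
      rw [map_smul, symb_single, hone, Algebra.algebraMap_eq_smul_one]
    | add x y _ _ hx hy => exact add_mem hx hy
    | mul x y _ _ hx hy =>
      obtain ⟨F, rfl⟩ := hx
      obtain ⟨G, rfl⟩ := hy
      simp only [symb, Finsupp.lsum_apply, Finsupp.sum, Finset.sum_mul_sum]
      refine sum_mem fun m _ => sum_mem fun r _ => ?_
      rw [symOp_mul]
      exact ⟨_, symb_single _ _⟩
  · rintro ⟨F, rfl⟩
    simp only [symb, Finsupp.lsum_apply, Finsupp.sum]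
    exact sum_mem fun m _ => symOp_mem m _

/-- Families of symbols are the same as differential operators. -/
def symbEquiv (ν : ℕ) : ((Fin ν → ℤ) →₀ MvPolynomial (Fin ν) ℂ) ≃ₗ[ℂ] DiffLie ν :=
  LinearEquiv.ofBijective
    (show ((Fin ν → ℤ) →₀ MvPolynomial (Fin ν) ℂ) →ₗ[ℂ] DiffLie ν from
      (symb ν).codRestrict (Subalgebra.toSubmodule (diffAlg ν)) fun F =>
        (mem_diffAlg_iff _).2 ⟨F, rfl⟩)
    ⟨fun F G h => symb_injective (congrArg Subtype.val h), fun a => by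
      obtain ⟨F, hF⟩ := (mem_diffAlg_iff a.1).1 a.2
      exact ⟨F, Subtype.ext hF⟩⟩

/-- The basis of `𝒟_ν` that consists of the elements `t^m D^n`; see `diffBasis_apply`. -/
def diffBasis (ν : ℕ) : Module.Basis ((Fin ν → ℤ) × (Fin ν →₀ ℕ)) ℂ (DiffLie ν) :=
  ((Finsupp.basis fun _ : Fin ν → ℤ => MvPolynomial.basisMonomials (Fin ν) ℂ).map
    (symbEquiv ν)).reindex (Equiv.sigmaEquivProd _ _)

theorem symbEquiv_single (m : Fin ν → ℤ) (p : MvPolynomial (Fin ν) ℂ) :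
    symbEquiv ν (Finsupp.single m p) = ⟨symOp m p, symOp_mem m p⟩ :=
  Subtype.ext (symb_single m p)

theorem diffBasis_apply (m : Fin ν → ℤ) (n : Fin ν →₀ ℕ) : diffBasis ν (m, n) = tD m n := by
  have : diffBasis ν (m, n) = symbEquiv ν (Finsupp.single m (MvPolynomial.monomial n 1)) := by
    simp [diffBasis]
  rw [this, symbEquiv_single]
  exact Subtype.ext (diffOp_eq m n).symm

/-! ### The modules `Ω(Λ, ε)` -/

/-- The operator
`f(x) ↦ β^{1 - ∑ n_i} Λ^m ∏_j (x_j - ε m_j)^{n_j} f(x₁ - m₁, …, x_ν - m_ν)`, `β = (-1)^{1-ε}`,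
by which `t^m D^n` acts on `Ω(Λ, ε) = ℂ[x₁, …, x_ν]`. -/
def omegaOp (Λ : Fin ν → ℂˣ) (ε : Fin 2) (m : Fin ν → ℤ) (n : Fin ν →₀ ℕ) :
    Module.End ℂ (MvPolynomial (Fin ν) ℂ) :=
  (((-1 : ℂ) ^ (1 - (ε : ℕ))) ^ (1 - ∑ i, (n i : ℤ)) * ∏ i, (Λ i : ℂ) ^ m i) •
    (LinearMap.mulLeft ℂ
        (∏ j, (MvPolynomial.X j - MvPolynomial.C (((ε : ℕ) : ℂ) * (m j : ℂ))) ^ n j) ∘ₗ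
      (translate m).toLinearMap)

/-- The linear map `𝒟_ν → End ℂ[x₁, …, x_ν]` sending each `t^m D^n` to `omegaOp Λ ε m n`. -/
def omegaMap (Λ : Fin ν → ℂˣ) (ε : Fin 2) :
    DiffLie ν →ₗ[ℂ] Module.End ℂ (MvPolynomial (Fin ν) ℂ) :=
  (diffBasis ν).constr ℂ fun mn => omegaOp Λ ε mn.1 mn.2

theorem omegaMap_tD (Λ : Fin ν → ℂˣ) (ε : Fin 2) (m : Fin ν → ℤ) (n : Fin ν →₀ ℕ) :
    omegaMap Λ ε (tD m n) = omegaOp Λ ε m n := by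
  rw [← diffBasis_apply, omegaMap, Module.Basis.constr_basis]

/-- `p(x) ↦ p(-x)`. -/
def negVar (ν : ℕ) : MvPolynomial (Fin ν) ℂ →ₐ[ℂ] MvPolynomial (Fin ν) ℂ :=
  MvPolynomial.aeval fun i => -MvPolynomial.X i

theorem negVar_translate (r : Fin ν → ℤ) (p : MvPolynomial (Fin ν) ℂ) :
    negVar ν (translate (-r) p) = translate r (negVar ν p) := by
  have h : (negVar ν).comp (translate (-r)) = (translate r).comp (negVar ν) := by
    ext i : 1
    simp [translate, negVar]
    ring
  exact DFunLike.congr_fun h p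

/-- `t^m p(D)` as an element of `𝒟_ν`. -/
def tp (m : Fin ν → ℤ) (p : MvPolynomial (Fin ν) ℂ) : DiffLie ν := ⟨symOp m p, symOp_mem m p⟩

theorem tp_add (m : Fin ν → ℤ) (p q : MvPolynomial (Fin ν) ℂ) : tp m (p + q) = tp m p + tp m q :=
  Subtype.ext (map_add (symOp m) p q)

theorem tp_monomial (m : Fin ν → ℤ) (n : Fin ν →₀ ℕ) (c : ℂ) :
    tp m (MvPolynomial.monomial n c) = c • tD m n := by
  have : MvPolynomial.monomial n c = c • MvPolynomial.monomial n (1 : ℂ) := by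
    simp [MvPolynomial.smul_monomial]
  refine Subtype.ext ?_
  change symOp m _ = c • diffOp m n
  rw [this, map_smul, ← diffOp_eq]

theorem tp_lie (m r : Fin ν → ℤ) (p q : MvPolynomial (Fin ν) ℂ) :
    ⁅tp m p, tp r q⁆ = tp (m + r) (translate (-r) p * q) - tp (r + m) (translate (-m) q * p) := by
  refine incl_injective ?_
  rw [incl_lie, map_sub]
  exact congrArg₂ _ (symOp_mul m r p q) (symOp_mul r m q p)

theorem span_tp (a : DiffLie ν) :
    a ∈ Submodule.span ℂ (Set.range fun x : (Fin ν → ℤ) × MvPolynomial (Fin ν) ℂ => tp x.1 x.2) := by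
  obtain ⟨F, rfl⟩ := (symbEquiv ν).surjective a
  induction F using Finsupp.induction_linear with
  | zero => simp
  | add F G hF hG => rw [map_add]; exact add_mem hF hG
  | single m p =>
    rw [symbEquiv_single]
    exact Submodule.subset_span ⟨(m, p), rfl⟩

theorem omegaMap_tp_one (Λ : Fin ν → ℂˣ) (m : Fin ν → ℤ) (p f : MvPolynomial (Fin ν) ℂ) :
    omegaMap Λ 1 (tp m p) f = (∏ i, (Λ i : ℂ) ^ m i) • translate m (p * f) := by
  induction p using MvPolynomial.induction_on' with
  | monomial n c =>
    rw [tp_monomial, map_smul, omegaMap_tD, map_mul]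
    have : translate m (MvPolynomial.monomial n c) =
        c • ∏ j, (MvPolynomial.X j - MvPolynomial.C (m j : ℂ)) ^ n j := by
      rw [translate, MvPolynomial.aeval_monomial, Finsupp.prod_fintype _ _ (by simp),
        ← Algebra.smul_def]
    rw [this]
    simp [omegaOp, smul_smul, mul_comm]
  | add p q hp hq => rw [tp_add, map_add, LinearMap.add_apply, hp, hq, add_mul, map_add, smul_add]

theorem omegaMap_tp_zero (Λ : Fin ν → ℂˣ) (m : Fin ν → ℤ) (p f : MvPolynomial (Fin ν) ℂ) :
    omegaMap Λ 0 (tp m p) f = -((∏ i, (Λ i : ℂ) ^ m i) • (negVar ν p * translate m f)) := by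
  induction p using MvPolynomial.induction_on' with
  | monomial n c =>
    rw [tp_monomial, map_smul, omegaMap_tD]
    have h1 : ((-1 : ℂ)) ^ (1 - ∑ i, (n i : ℤ)) = -∏ i, (-1 : ℂ) ^ n i := by
      rw [zpow_sub₀ (by norm_num), zpow_one, Finset.prod_pow_eq_pow_sum, ← Nat.cast_sum,
        zpow_natCast, div_eq_mul_inv, ← inv_pow, inv_neg_one, neg_one_mul]
    have h2 : negVar ν (MvPolynomial.monomial n c) =
        (c * ∏ i, (-1 : ℂ) ^ n i) • ∏ j, (MvPolynomial.X j : MvPolynomial (Fin ν) ℂ) ^ n j := by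
      rw [negVar, MvPolynomial.aeval_monomial, Finsupp.prod_fintype _ _ (by simp),
        ← Algebra.smul_def, mul_smul]
      congr 1
      rw [MvPolynomial.smul_eq_C_mul, map_prod, ← Finset.prod_mul_distrib]
      refine Finset.prod_congr rfl fun i _ => ?_
      rw [neg_pow]
      simp
    rw [h2]
    simp only [omegaOp, Fin.val_zero, Nat.sub_zero, pow_one, h1]
    simp only [LinearMap.smul_apply, LinearMap.comp_apply, LinearMap.mulLeft_apply, smul_smul,
      Nat.cast_zero, zero_mul, map_zero, sub_zero, AlgHom.toLinearMap_apply, smul_mul_assoc,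
      ← neg_smul]
    congr 1
    ring
  | add p q hp hq =>
    rw [tp_add, map_add, LinearMap.add_apply, hp, hq, map_add, add_mul, smul_add, neg_add]

theorem prod_zpow_add (Λ : Fin ν → ℂˣ) (m r : Fin ν → ℤ) :
    ∏ i, (Λ i : ℂ) ^ (m + r) i = (∏ i, (Λ i : ℂ) ^ m i) * ∏ i, (Λ i : ℂ) ^ r i := by
  rw [← Finset.prod_mul_distrib]
  exact Finset.prod_congr rfl fun i _ => zpow_add₀ (Λ i).ne_zero _ _

theorem omegaMap_lie (Λ : Fin ν → ℂˣ) (ε : Fin 2) (a b : DiffLie ν) :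
    omegaMap Λ ε ⁅a, b⁆ = omegaMap Λ ε a * omegaMap Λ ε b - omegaMap Λ ε b * omegaMap Λ ε a := by
  induction span_tp a using Submodule.span_induction with
  | zero => simp
  | add x y _ _ hx hy => rw [add_lie, map_add, hx, hy, map_add]; noncomm_ring
  | smul c x _ hx => rw [smul_lie, map_smul, hx, map_smul, smul_sub, smul_mul_assoc, mul_smul_comm]
  | mem x hx =>
    obtain ⟨⟨m, p⟩, rfl⟩ := hx
    induction span_tp b using Submodule.span_induction with
    | zero => simp
    | add x y _ _ hx hy => rw [lie_add, map_add, hx, hy, map_add]; noncomm_ring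
    | smul c x _ hx =>
      rw [lie_smul, map_smul, hx, map_smul, smul_sub, smul_mul_assoc, mul_smul_comm]
    | mem y hy =>
      obtain ⟨⟨r, q⟩, rfl⟩ := hy
      refine LinearMap.ext fun f => ?_
      simp only [tp_lie, map_sub, LinearMap.sub_apply, Module.End.mul_apply]
      fin_cases ε
      · simp only [Fin.zero_eta, omegaMap_tp_zero, map_mul, negVar_translate, prod_zpow_add, map_neg,
          map_smul, translate_translate, smul_smul, smul_neg, neg_neg]
        rw [mul_comm (∏ i, (Λ i : ℂ) ^ r i), add_comm r m]
        generalize (∏ i, (Λ i : ℂ) ^ m i) * ∏ i, (Λ i : ℂ) ^ r i = c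
        simp only [MvPolynomial.smul_eq_C_mul]
        ring
      · simp only [Fin.mk_one, omegaMap_tp_one, map_mul, translate_translate, prod_zpow_add,
          map_smul, smul_smul, add_neg_cancel_right, mul_assoc]
        rw [mul_comm (∏ i, (Λ i : ℂ) ^ r i), add_comm r m]

/-- The underlying space `ℂ[x₁, …, x_ν]` of `Ω(Λ, ε)`. -/
def Omega (_Λ : Fin ν → ℂˣ) (_ε : Fin 2) : Type := MvPolynomial (Fin ν) ℂ

instance (Λ : Fin ν → ℂˣ) (ε : Fin 2) : AddCommGroup (Omega Λ ε) :=
  inferInstanceAs (AddCommGroup (MvPolynomial (Fin ν) ℂ))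

instance (Λ : Fin ν → ℂˣ) (ε : Fin 2) : Module ℂ (Omega Λ ε) :=
  inferInstanceAs (Module ℂ (MvPolynomial (Fin ν) ℂ))

instance (Λ : Fin ν → ℂˣ) (ε : Fin 2) : LieRingModule (DiffLie ν) (Omega Λ ε) where
  bracket a f := omegaMap Λ ε a f
  add_lie a b f := by
    exact LinearMap.congr_fun (map_add (omegaMap Λ ε) a b) f
  lie_add a f g := map_add (omegaMap Λ ε a) f g
  leibniz_lie a b f := by
    exact sub_eq_iff_eq_add.1 (LinearMap.congr_fun (omegaMap_lie Λ ε a b) f).symm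

instance (Λ : Fin ν → ℂˣ) (ε : Fin 2) : LieModule ℂ (DiffLie ν) (Omega Λ ε) where
  smul_lie c a f := by
    exact LinearMap.congr_fun (map_smul (omegaMap Λ ε) c a) f
  lie_smul c a f := map_smul (omegaMap Λ ε a) c f

/-- The action of `t^m D^n` on `Ω(Λ, ε)`. -/
theorem tD_lie_omega (Λ : Fin ν → ℂˣ) (ε : Fin 2) (m : Fin ν → ℤ) (n : Fin ν →₀ ℕ)
    (f : MvPolynomial (Fin ν) ℂ) :
    (⁅tD m n, (show Omega Λ ε from f)⁆ : Omega Λ ε) = omegaOp Λ ε m n f :=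
  LinearMap.congr_fun (omegaMap_tD Λ ε m n) f

/-! ### The subalgebra `𝔥_ν` and modules that are free of rank one over `U(𝔥_ν)` -/

theorem eulerD_lie (i j : Fin ν) : ⁅(eulerD i : DiffLie ν), (eulerD j : DiffLie ν)⁆ = 0 := by
  refine incl_injective (end_ext fun k => ?_)
  change (euler i * euler j - euler j * euler i) (tpow k) = 0
  simp [euler_tpow, smul_smul, mul_comm]

/-- The Cartan subalgebra `𝔥_ν = span {D₁, …, D_ν}` of `𝒟_ν`. -/
def cartan (ν : ℕ) : LieSubalgebra ℂ (DiffLie ν) :=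
  { Submodule.span ℂ (Set.range (eulerD : Fin ν → DiffLie ν)) with
    lie_mem' := by
      intro x y hx hy
      have h : ⁅x, y⁆ = 0 := by
        induction hx using Submodule.span_induction with
        | zero => simp
        | add a b _ _ ha hb => rw [add_lie, ha, hb, add_zero]
        | smul c a _ ha => rw [smul_lie, ha, smul_zero]
        | mem a ha =>
          obtain ⟨i, rfl⟩ := ha
          induction hy using Submodule.span_induction with
          | zero => simp
          | add a b _ _ ha hb => rw [lie_add, ha, hb, add_zero]
          | smul c a _ ha => rw [lie_smul, ha, smul_zero]
          | mem b hb =>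
            obtain ⟨j, rfl⟩ := hb
            exact eulerD_lie i j
      rw [h]
      exact Submodule.zero_mem _ }

/-- A module `M` over a Lie algebra `L` as a left module over the enveloping algebra `U(L)`. -/
abbrev envelopingModule (L : Type*) [LieRing L] [LieAlgebra ℂ L] (M : Type*) [AddCommGroup M]
    [Module ℂ M] [LieRingModule L M] [LieModule ℂ L M] :
    Module (UniversalEnvelopingAlgebra ℂ L) M :=
  Module.compHom M
    (UniversalEnvelopingAlgebra.lift ℂ (LieModule.toEnd ℂ L M)).toRingHom

/-- `M`, regarded as a left module over `U(L)`, is free of rank one, i.e. isomorphic to `U(L)`. -/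
def IsFreeOfRankOne (L : Type*) [LieRing L] [LieAlgebra ℂ L] (M : Type*) [AddCommGroup M]
    [Module ℂ M] [LieRingModule L M] [LieModule ℂ L M] : Prop :=
  letI := envelopingModule L M
  Nonempty (M ≃ₗ[UniversalEnvelopingAlgebra ℂ L] UniversalEnvelopingAlgebra ℂ L)

end DiffOpModule

end

/-!
A module `M` as in the theorem may be taken to be `ℂ[x₁, …, x_ν]` with `D_i` acting as
multiplication by `x_i`, since `U(𝔥_ν)` is the polynomial algebra in the `D_i` (`lift_cartanSymbol_bijective`). As
`[D_i, t^m p(D)] = m_i t^m p(D)`, the element `t^m p(D)` then acts as `f ↦ f(x - m) g(m, p)` with a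
polynomial `g(m, p)` that is linear in `p` (`transportOp_tp`). So `M` is described by the family
`g`, and the relations of `𝒟_ν` become functional equations for it (`IsSymbolFamily`), which are
solved as follows.

*The values at `1` are constants.* The commutators `[t_i D_i, t_i⁻¹ D_i]`, `[t_i, t_i⁻¹ D_i]` and
`[t_i⁻¹, t_i D_i]` say that certain products of two of the polynomials `g(± e_i, D_i)` and
`g(± e_i, 1)`, up to translations, have prescribed differences in the direction `e_i`, and hence
degrees `2`, `1`, `1` in `x_i`. Thus `g(± e_i, 1)` has degree `0` in `x_i`
(`exists_apply_single_one`). Since all `t^m` commute with the `t_i`, every `g(m, 1)` is a constant,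
and the commutators `[t^m, t^r D_i]` show that `m ↦ g(m, 1)` is a multiple `c Λ^m` of a character
(`mul_eq_of_ratio`, `exists_eq_prod_zpow`). After division by `Λ^m`, all `g(m, 1)` equal `c`.

*The module is determined by a number `α`.* Commutators with `p(D)` show that, for `m ≠ 0`, the map
`p ↦ g(m, p)` is an algebra homomorphism up to the factor `c` (`mul_apply_mul`), so that it is
determined by the values at the `D_i`. Commutators of elements `t^m D_i`, `t^m D_i^2` and `t^m` give
`g(m, D_i) = x_i - α m_i` with `c = 2α - 1` and `α^2 = α` (`exists_apply_X_eq`). The two solutions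
`α = 1` and `α = 0` are the modules `Ω(Λ, 1)` and `Ω(Λ, 0)`; the case `m = 0` follows because every
`p(D)` is a commutator `[t_i⁻¹ q(D), t_i]` (`exists_translate_sub_eq`).
-/

noncomputable section

attribute [local instance] LieRing.ofAssociativeRing

namespace DiffOpModule

open MvPolynomial

variable {ν : ℕ}

/-! ### Translations of polynomials -/

theorem translate_X (m : Fin ν → ℤ) (i : Fin ν) : translate m (X i) = X i - C (m i : ℂ) := by
  simp [translate]

theorem translate_C (m : Fin ν → ℤ) (a : ℂ) : translate m (C a) = C a := by
  simp [translate]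

theorem translate_zero (p : MvPolynomial (Fin ν) ℂ) : translate 0 p = p := by
  have h : translate (0 : Fin ν → ℤ) = AlgHom.id ℂ _ := by
    ext i : 1
    simp [translate]
  rw [h, AlgHom.id_apply]

theorem translate_neg_translate (m : Fin ν → ℤ) (p : MvPolynomial (Fin ν) ℂ) :
    translate (-m) (translate m p) = p := by
  rw [translate_translate, neg_add_cancel, translate_zero]

theorem translate_translate_neg (m : Fin ν → ℤ) (p : MvPolynomial (Fin ν) ℂ) :
    translate m (translate (-m) p) = p := by
  rw [translate_translate, add_neg_cancel, translate_zero]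

theorem translate_eq_zero {m : Fin ν → ℤ} {p : MvPolynomial (Fin ν) ℂ} :
    translate m p = 0 ↔ p = 0 :=
  ⟨fun h => by rw [← translate_neg_translate m p, h, map_zero], fun h => by rw [h, map_zero]⟩

/-- The vectors `e_i` generate `ℤ^ν`. -/
theorem closure_single_one (ν : ℕ) :
    AddSubgroup.closure (Set.range fun i : Fin ν => (Pi.single i 1 : Fin ν → ℤ)) = ⊤ := by
  refine (AddSubgroup.eq_top_iff' _).2 fun m => ?_
  have h : m = ∑ i, m i • (Pi.single i 1 : Fin ν → ℤ) := by
    ext j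
    simp [Finset.sum_apply, Pi.single_apply]
  rw [h]
  exact sum_mem fun i _ => zsmul_mem (AddSubgroup.subset_closure (Set.mem_range_self i)) _

/-- A polynomial that is invariant under the integer translations is constant, because it takes the
same value at all integer points. -/
theorem eq_C_of_translate_eq {f : MvPolynomial (Fin ν) ℂ}
    (h : ∀ i, translate (Pi.single i 1) f = f) : ∃ a, f = C a := by
  have hm (m : Fin ν → ℤ) : translate m f = f := by
    have : m ∈ AddSubgroup.closure (Set.range fun i : Fin ν => (Pi.single i 1 : Fin ν → ℤ)) := by
      rw [closure_single_one]; trivial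
    induction this using AddSubgroup.closure_induction with
    | mem x hx => obtain ⟨i, rfl⟩ := hx; exact h i
    | zero => exact translate_zero f
    | add x y _ _ hx hy => rw [← translate_translate, hy, hx]
    | neg x _ hx => nth_rw 1 [← hx]; exact translate_neg_translate x f
  refine ⟨eval 0 f, funext_set (fun _ => Set.range ((↑) : ℤ → ℂ))
    (fun _ => Set.infinite_range_of_injective Int.cast_injective) fun x hx => ?_⟩
  choose k hk using fun i => hx i trivial
  have hx' : x = pt k := (funext hk).symm
  have hev : eval (0 : Fin ν → ℂ) (translate (-k) f) = eval (pt k) f := by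
    rw [← coe_aeval_eq_eval, ← coe_aeval_eq_eval, RingHom.coe_coe, RingHom.coe_coe,
      ← AlgHom.comp_apply]
    congr 1
    ext i : 1
    simp [translate, pt]
  rw [hx', ← hev, hm, eval_C]

/-- The polynomial `f(x + s e_i)` in the variable `s`. -/
def alongLine (i : Fin ν) : MvPolynomial (Fin ν) ℂ →ₐ[ℂ] Polynomial (MvPolynomial (Fin ν) ℂ) :=
  aeval fun j => Polynomial.C (X j) + (Pi.single i Polynomial.X : Fin ν → Polynomial _) j

/-- The degree of `f` in the variable `x_i`. -/
def lineDeg (i : Fin ν) (f : MvPolynomial (Fin ν) ℂ) : ℕ := (alongLine i f).natDegree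

theorem alongLine_C (i : Fin ν) (a : ℂ) : alongLine i (C a) = Polynomial.C (C a) := by
  rw [alongLine, aeval_C]
  rfl

theorem alongLine_X (i : Fin ν) :
    alongLine i (X i) = Polynomial.C (X i) + Polynomial.X := by
  simp [alongLine]

theorem alongLine_X_of_ne {i j : Fin ν} (h : j ≠ i) :
    alongLine i (X j) = Polynomial.C (X j) := by
  simp [alongLine, h]

theorem eval_alongLine (i : Fin ν) (a : ℤ) (f : MvPolynomial (Fin ν) ℂ) :
    (alongLine i f).eval (C (a : ℂ)) = translate (Pi.single i (-a)) f := by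
  induction f using MvPolynomial.induction_on with
  | C c => rw [alongLine_C, translate_C, Polynomial.eval_C]
  | add p q hp hq => rw [map_add, Polynomial.eval_add, hp, hq, map_add]
  | mul_X p j hp =>
    rw [map_mul, Polynomial.eval_mul, hp, map_mul]
    congr 1
    by_cases h : j = i
    · subst h
      simp [alongLine_X, translate_X]
    · simp [alongLine, translate, h]

theorem alongLine_injective (i : Fin ν) : Function.Injective (alongLine i) := by
  refine (injective_iff_map_eq_zero _).2 fun f hf => ?_
  have := eval_alongLine i 0 f
  rw [hf, neg_zero, Pi.single_zero, translate_zero] at this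
  simpa using this.symm

theorem lineDeg_mul (i : Fin ν) {f g : MvPolynomial (Fin ν) ℂ} (hf : f ≠ 0) (hg : g ≠ 0) :
    lineDeg i (f * g) = lineDeg i f + lineDeg i g := by
  rw [lineDeg, map_mul]
  exact Polynomial.natDegree_mul (by simpa using (alongLine_injective i).ne hf)
    (by simpa using (alongLine_injective i).ne hg)

theorem lineDeg_translate (i : Fin ν) (a : ℤ) (f : MvPolynomial (Fin ν) ℂ) :
    lineDeg i (translate (Pi.single i a) f) = lineDeg i f := by
  have h : alongLine i (translate (Pi.single i a) f) =
      (alongLine i f).comp (Polynomial.X - Polynomial.C (C (a : ℂ))) := by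
    induction f using MvPolynomial.induction_on with
    | C c => rw [translate_C, alongLine_C, Polynomial.C_comp]
    | add p q hp hq => rw [map_add, map_add, map_add, Polynomial.add_comp, hp, hq]
    | mul_X p j hp =>
      rw [map_mul, map_mul, map_mul, Polynomial.mul_comp, hp]
      refine congrArg _ ?_
      rw [translate_X, map_sub, alongLine_C]
      by_cases h : j = i
      · subst h
        rw [alongLine_X, Pi.single_eq_same, Polynomial.add_comp, Polynomial.C_comp,
          Polynomial.X_comp, add_sub_assoc]
      · rw [alongLine_X_of_ne h, Pi.single_eq_of_ne h, Polynomial.C_comp]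
        simp
  rw [lineDeg, h, Polynomial.natDegree_comp, Polynomial.natDegree_X_sub_C, mul_one, lineDeg]

/-- A polynomial that is invariant under the translation by `e_i` does not involve `x_i`. -/
theorem alongLine_eq_C {i : Fin ν} {f : MvPolynomial (Fin ν) ℂ}
    (h : translate (Pi.single i 1) f = f) : alongLine i f = Polynomial.C f := by
  have hn (n : ℕ) : translate (Pi.single i (-(n : ℤ))) f = f := by
    induction n with
    | zero => simp [translate_zero]
    | succ n ih =>
      nth_rw 1 [← h]
      rw [translate_translate, ← Pi.single_add]
      simpa using ih
  refine Polynomial.eq_of_infinite_eval_eq _ _ ?_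
  refine Set.Infinite.mono ?_ (Set.infinite_range_of_injective
    (f := fun n : ℕ => (C (((n : ℕ) : ℤ) : ℂ) : MvPolynomial (Fin ν) ℂ)) fun a b hab => ?_)
  · rintro _ ⟨n, rfl⟩
    rw [Set.mem_ofPred_eq, eval_alongLine, hn, Polynomial.eval_C]
  · simpa using C_injective _ _ hab

theorem lineDeg_eq_zero {i : Fin ν} {f : MvPolynomial (Fin ν) ℂ}
    (h : translate (Pi.single i 1) f = f) : lineDeg i f = 0 := by
  rw [lineDeg, alongLine_eq_C h, Polynomial.natDegree_C]

theorem translate_eq_of_lineDeg_eq_zero {i : Fin ν} {f : MvPolynomial (Fin ν) ℂ}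
    (h : lineDeg i f = 0) (a : ℤ) : translate (Pi.single i a) f = f := by
  have h1 (b : ℤ) : translate (Pi.single i (-b)) f = (alongLine i f).coeff 0 := by
    rw [← eval_alongLine, Polynomial.eq_C_of_natDegree_eq_zero h, Polynomial.eval_C,
      Polynomial.coeff_C_zero]
  have h2 := h1 0
  rw [neg_zero, Pi.single_zero, translate_zero] at h2
  rw [← neg_neg a, h1, ← h2]

/-- If `f(x - e_i) = f(x) - a` with a non-zero number `a`, then `f` has degree one in `x_i`. -/
theorem lineDeg_eq_one {i : Fin ν} {f : MvPolynomial (Fin ν) ℂ} {a : ℂ} (ha : a ≠ 0)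
    (h : translate (Pi.single i 1) f = f - C a) : lineDeg i f = 1 := by
  have h1 : translate (Pi.single i 1) (f - C a * X i) = f - C a * X i := by
    rw [map_sub, map_mul, translate_C, translate_X, h]
    simp
    ring
  have h2 := alongLine_eq_C h1
  rw [map_sub, map_mul, alongLine_C, alongLine_X, sub_eq_iff_eq_add] at h2
  have h3 : alongLine i f = Polynomial.C (C a) * Polynomial.X + Polynomial.C f := by
    rw [h2]
    simp
    ring
  rw [lineDeg, h3, Polynomial.natDegree_linear (by simpa using ha)]

/-- If `f(x - e_i) = f(x) - 2 x_i`, then `f` has degree two in `x_i`. -/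
theorem lineDeg_eq_two {i : Fin ν} {f : MvPolynomial (Fin ν) ℂ}
    (h : translate (Pi.single i 1) f = f - 2 * X i) : lineDeg i f = 2 := by
  have h1 : translate (Pi.single i 1) (f - X i ^ 2 - X i) = f - X i ^ 2 - X i := by
    rw [map_sub, map_sub, map_pow, translate_X, h]
    simp
    ring
  have h2 := alongLine_eq_C h1
  rw [map_sub, map_sub, map_pow, alongLine_X, sub_eq_iff_eq_add, sub_eq_iff_eq_add] at h2
  have h3 : alongLine i f = Polynomial.C 1 * Polynomial.X ^ 2 +
      Polynomial.C (2 * X i + 1) * Polynomial.X + Polynomial.C f := by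
    rw [h2]
    have h4 : (Polynomial.C 2 : Polynomial (MvPolynomial (Fin ν) ℂ)) = 2 := rfl
    simp only [map_add, map_sub, map_mul, map_pow, map_one, h4]
    ring
  rw [lineDeg, h3, Polynomial.natDegree_quadratic one_ne_zero]

/-- The difference operator in the direction `e_i` is onto: Bernoulli polynomials provide
antidifferences of the powers of `x_i`. -/
theorem exists_translate_sub_eq (i : Fin ν) (q : MvPolynomial (Fin ν) ℂ) :
    ∃ p, translate (-Pi.single i 1) p - p = q := by
  induction q using MvPolynomial.induction_on' with
  | add q₁ q₂ h₁ h₂ =>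
    obtain ⟨p₁, rfl⟩ := h₁
    obtain ⟨p₂, rfl⟩ := h₂
    exact ⟨p₁ + p₂, by rw [map_add]; ring⟩
  | monomial n c =>
    have hn : n.erase i + Finsupp.single i (n i) = n := Finsupp.erase_add_single i n
    set d := n i
    set w : MvPolynomial (Fin ν) ℂ := monomial (n.erase i) c
    have hw : translate (-Pi.single i 1) w = w := by
      simp only [w, monomial_eq, Finsupp.prod, map_mul, map_prod, map_pow, translate_C, translate_X]
      congr 1
      refine Finset.prod_congr rfl fun j hj => ?_
      have : j ≠ i := by rintro rfl; simp at hj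
      simp [this]
    have hb := congrArg (Polynomial.aeval (X i : MvPolynomial (Fin ν) ℂ))
      (Polynomial.bernoulli_comp_one_add_X (d + 1))
    have ht : translate (-Pi.single i 1)
          (Polynomial.aeval (X i : MvPolynomial (Fin ν) ℂ) (Polynomial.bernoulli (d + 1))) =
        Polynomial.aeval (X i) ((Polynomial.bernoulli (d + 1)).comp (1 + Polynomial.X)) := by
      have h1 : ((translate (-Pi.single i 1)).restrictScalars ℚ) (X i : MvPolynomial (Fin ν) ℂ) =
          Polynomial.aeval (X i) (1 + Polynomial.X : Polynomial ℚ) := by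
        simp [translate_X, add_comm]
      rw [Polynomial.aeval_comp, ← h1, Polynomial.aeval_algHom_apply]
      rfl
    refine ⟨C ((d + 1 : ℂ)⁻¹) *
      (w * Polynomial.aeval (X i : MvPolynomial (Fin ν) ℂ) (Polynomial.bernoulli (d + 1))), ?_⟩
    rw [map_mul, map_mul, translate_C, hw, ht, hb, ← hn, ← mul_one c, ← monomial_mul]
    have h2 : C ((d + 1 : ℂ)⁻¹) * ((d : MvPolynomial (Fin ν) ℂ) + 1) = 1 := by
      have : ((d : MvPolynomial (Fin ν) ℂ) + 1) = C (d + 1 : ℂ) := by simp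
      rw [this, ← C_mul, inv_mul_cancel₀ (Nat.cast_add_one_ne_zero d), C_1]
    rw [← X_pow_eq_monomial]
    simp only [map_add, map_mul, map_pow, Polynomial.aeval_X, map_natCast, map_one, nsmul_eq_mul,
      Nat.add_sub_cancel, Nat.cast_add, Nat.cast_one]
    linear_combination (w * X i ^ d) * h2

/-! ### Symbol families and their values at `1` -/

/-- The data that describe a `𝒟_ν`-module structure on `ℂ[x₁, …, x_ν]` in which each `D_i` acts as
multiplication by `x_i`: then `t^m p(D)` acts as `f ↦ f(x - m) g(m, p)`, where `g(m, p)` is the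
image of `1`. The field `bracket` is the compatibility with commutators. -/
structure IsSymbolFamily
    (g : (Fin ν → ℤ) → MvPolynomial (Fin ν) ℂ →ₗ[ℂ] MvPolynomial (Fin ν) ℂ) : Prop where
  zero_X (i : Fin ν) : g 0 (X i) = X i
  bracket (m r : Fin ν → ℤ) (p q : MvPolynomial (Fin ν) ℂ) :
    translate m (g r q) * g m p - translate r (g m p) * g r q =
      g (m + r) (translate (-r) p * q - translate (-m) q * p)

theorem map_C (h : MvPolynomial (Fin ν) ℂ →ₗ[ℂ] MvPolynomial (Fin ν) ℂ) (a : ℂ) :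
    h (C a) = C a * h 1 := by
  rw [← smul_eq_C_mul, ← map_smul, smul_eq_C_mul, mul_one]

theorem map_C_mul (h : MvPolynomial (Fin ν) ℂ →ₗ[ℂ] MvPolynomial (Fin ν) ℂ) (a : ℂ)
    (p : MvPolynomial (Fin ν) ℂ) : h (C a * p) = C a * h p := by
  rw [← smul_eq_C_mul, map_smul, smul_eq_C_mul]

namespace IsSymbolFamily

variable {g : (Fin ν → ℤ) → MvPolynomial (Fin ν) ℂ →ₗ[ℂ] MvPolynomial (Fin ν) ℂ}

theorem bracket_one_X (hg : IsSymbolFamily g) (m r : Fin ν → ℤ) (i : Fin ν) :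
    translate m (g r (X i)) * g m 1 - translate r (g m 1) * g r (X i) =
      -(C (m i : ℂ) * g (m + r) 1) := by
  rw [hg.bracket, map_one, one_mul, mul_one, translate_X, ← map_C, ← map_neg]
  congr 1
  simp

/-- If `t^m` acted as zero for some `m ≠ 0`, then so would all `t^r`, because
`[t^m, t^{r-m} D_i] = -m_i t^r`, and hence so would `D_i`. -/
theorem apply_one_ne_zero (hg : IsSymbolFamily g) {m : Fin ν → ℤ} {i : Fin ν} (hm : m i ≠ 0) :
    g m 1 ≠ 0 := by
  intro h0
  have hm' : (C (m i : ℂ) : MvPolynomial (Fin ν) ℂ) ≠ 0 := by simpa using hm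
  have h1 (r : Fin ν → ℤ) : g r 1 = 0 := by
    have h := hg.bracket_one_X m (r - m) i
    rw [h0, map_zero, mul_zero, zero_mul, sub_zero, add_sub_cancel, zero_eq_neg] at h
    exact (mul_eq_zero.1 h).resolve_left hm'
  have h2 := hg.bracket m (-m) 1 (X i ^ 2)
  have h3 : translate (- -m) 1 * X i ^ 2 - translate (-m) (X i ^ 2) * 1 =
      -(C (2 * m i : ℂ) * X i) - C ((m i : ℂ) ^ 2) := by
    have h4 : (C 2 : MvPolynomial (Fin ν) ℂ) = 2 := rfl
    simp only [map_one, map_pow, map_mul, translate_X, Pi.neg_apply, Int.cast_neg, map_neg, h4]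
    ring
  rw [h3, add_neg_cancel, h1, map_zero, mul_zero, zero_mul, sub_zero, map_sub, map_neg, map_C, h1,
    map_C_mul, hg.zero_X, mul_zero, sub_zero, zero_eq_neg] at h2
  exact (mul_ne_zero (by simpa using hm) (X_ne_zero i)) h2

theorem translate_apply_one (hg : IsSymbolFamily g) (m r : Fin ν → ℤ) :
    translate m (g r 1) * g m 1 = translate r (g m 1) * g r 1 := by
  rw [← sub_eq_zero, hg.bracket]
  simp

/-- The relation `[t_i D_i, t_i⁻¹ D_i] = -2 D_i`, as a difference equation for the product of
`g(-e_i, D_i)` with a translate of `g(e_i, D_i)`; hence this product has degree two in `x_i`. -/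
theorem bracket_X_X (hg : IsSymbolFamily g) (i : Fin ν) :
    translate (Pi.single i 1)
        (translate (Pi.single i (-1)) (g (Pi.single i 1) (X i)) * g (Pi.single i (-1)) (X i)) =
      translate (Pi.single i (-1)) (g (Pi.single i 1) (X i)) * g (Pi.single i (-1)) (X i) -
        2 * X i := by
  have h := hg.bracket (Pi.single i 1) (Pi.single i (-1)) (X i) (X i)
  have h3 : translate (-Pi.single i (-1)) (X i) * X i - translate (-Pi.single i 1) (X i) * X i =
      -(C 2 * X i : MvPolynomial (Fin ν) ℂ) := by
    have h4 : (C 2 : MvPolynomial (Fin ν) ℂ) = 2 := rfl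
    simp only [translate_X, h4]
    simp
    ring
  have h5 : (C 2 : MvPolynomial (Fin ν) ℂ) = 2 := rfl
  rw [h3, ← Pi.single_add, add_neg_cancel, Pi.single_zero, map_neg, map_C_mul, hg.zero_X, h5] at h
  rw [map_mul, translate_translate, ← Pi.single_add, add_neg_cancel, Pi.single_zero, translate_zero]
  linear_combination h

theorem apply_X_ne_zero (hg : IsSymbolFamily g) (i : Fin ν) :
    g (Pi.single i 1) (X i) ≠ 0 ∧ g (Pi.single i (-1)) (X i) ≠ 0 := by
  have h := lineDeg_eq_two (hg.bracket_X_X i)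
  constructor <;> intro h0 <;> rw [h0] at h <;> simp [lineDeg] at h

/-- The central element `1` of `𝒟_ν` acts as a scalar. -/
theorem exists_apply_zero_one (hg : IsSymbolFamily g) : ∃ c, g 0 1 = C c := by
  refine eq_C_of_translate_eq fun i => ?_
  have h := hg.bracket 0 (Pi.single i 1) 1 (X i)
  rw [translate_zero, neg_zero, translate_zero, map_one (translate _), one_mul, mul_one, sub_self,
    map_zero, mul_comm, ← sub_mul] at h
  exact (sub_eq_zero.1 ((mul_eq_zero.1 h).resolve_right (hg.apply_X_ne_zero i).1)).symm

/-- `t_i` acts by a constant multiple of a translation. The three products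
`g(-e_i, D_i) g(e_i, D_i)`, `g(e_i, 1) g(-e_i, D_i)` and `g(-e_i, 1) g(e_i, D_i)`, up to
translations of the factors, have degrees `2`, `1` and `1` in `x_i`, so that `g(e_i, 1)` has degree `0`. -/
theorem exists_apply_single_one (hg : IsSymbolFamily g) (i : Fin ν) :
    g 0 1 ≠ 0 ∧ ∃ a, g (Pi.single i 1) 1 = C a := by
  obtain ⟨c, hc⟩ := hg.exists_apply_zero_one
  set e : Fin ν → ℤ := Pi.single i 1 with he
  set e' : Fin ν → ℤ := Pi.single i (-1) with he'
  have hee : e + e' = 0 := by rw [he, he', ← Pi.single_add, add_neg_cancel, Pi.single_zero]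
  have hee' : e' + e = 0 := by rw [add_comm, hee]
  obtain ⟨hu, hv⟩ := hg.apply_X_ne_zero i
  have hp : g e 1 ≠ 0 := hg.apply_one_ne_zero (i := i) (by simp [he])
  have hn : g e' 1 ≠ 0 := hg.apply_one_ne_zero (i := i) (by simp [he'])
  have hte {m} {f : MvPolynomial (Fin ν) ℂ} (hf : f ≠ 0) : translate m f ≠ 0 :=
    fun h => hf (translate_eq_zero.1 h)
  have h2 := lineDeg_eq_two (hg.bracket_X_X i)
  rw [lineDeg_mul i (hte hu) hv, lineDeg_translate] at h2
  have h3 : translate e (translate e' (g e 1) * g e' (X i)) =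
      translate e' (g e 1) * g e' (X i) - C c := by
    have h := hg.bracket_one_X e e' i
    rw [hee, hc, he, Pi.single_eq_same, Int.cast_one, C_1, one_mul, ← he] at h
    rw [map_mul, translate_translate, hee, translate_zero]
    linear_combination h
  have h4 : translate e (translate e (g e' 1) * g e (X i)) =
      translate e (g e' 1) * g e (X i) - C c := by
    have h := hg.bracket_one_X e' e i
    rw [hee', hc, he', Pi.single_eq_same, Int.cast_neg, Int.cast_one, C_neg, C_1, neg_one_mul,
      neg_neg, ← he'] at h
    have h' := congrArg (translate e) h
    rw [map_sub, map_mul, translate_translate, hee, translate_zero, translate_C] at h'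
    linear_combination -h'
  have hc0 : c ≠ 0 := by
    rintro rfl
    rw [C_0, sub_zero] at h3 h4
    have h5 := lineDeg_eq_zero h3
    have h6 := lineDeg_eq_zero h4
    rw [lineDeg_mul i (hte hp) hv] at h5
    rw [lineDeg_mul i (hte hn) hu] at h6
    omega
  refine ⟨by rwa [hc, Ne, C_eq_zero], ?_⟩
  have h5 := lineDeg_eq_one hc0 h3
  have h6 := lineDeg_eq_one hc0 h4
  rw [lineDeg_mul i (hte hp) hv, lineDeg_translate] at h5
  rw [lineDeg_mul i (hte hn) hu] at h6
  have h7 := translate_eq_of_lineDeg_eq_zero (i := i) (f := g e 1) (by omega)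
  rw [map_mul, h7, h7] at h3
  -- `g(e_i, 1)` divides the non-zero constant `c`
  have h8 : IsUnit (g e 1) := by
    refine isUnit_of_dvd_unit ⟨g e' (X i) - translate e (g e' (X i)), ?_⟩
      ((isUnit_iff_ne_zero.2 hc0).map (C : ℂ →+* MvPolynomial (Fin ν) ℂ))
    linear_combination h3
  obtain ⟨a, -, ha⟩ := isUnit_iff_eq_C_of_isReduced.1 h8
  exact ⟨a, ha⟩

/-- Every `t^m` acts by a constant multiple of a translation, because it commutes with the `t_i`. -/
theorem exists_apply_one (hg : IsSymbolFamily g) (m : Fin ν → ℤ) : ∃ a, g m 1 = C a := by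
  refine eq_C_of_translate_eq fun i => ?_
  obtain ⟨a, ha⟩ := (hg.exists_apply_single_one i).2
  have h := hg.translate_apply_one (Pi.single i 1) m
  have ha0 := hg.apply_one_ne_zero (m := Pi.single i 1) (i := i) (by simp)
  rw [ha] at h ha0
  rw [translate_C, mul_comm] at h
  exact mul_left_cancel₀ ha0 h

/-- `g(r, D_i) = a x_i + b`, where the slope `a` relates the scalars of `t^m` and `t^{m+r}`. -/
theorem apply_one_add (hg : IsSymbolFamily g) (r : Fin ν → ℤ) (i : Fin ν) :
    ∃ a : ℂ, ∀ m : Fin ν → ℤ, m i ≠ 0 → g (m + r) 1 = C a * g m 1 := by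
  choose γ hγ using hg.exists_apply_one
  have h (m : Fin ν → ℤ) : C (γ m) * (g r (X i) - translate m (g r (X i))) =
      C (m i : ℂ) * C (γ (m + r)) := by
    have := hg.bracket_one_X m r i
    rw [hγ, hγ, translate_C] at this
    linear_combination -this
  have hγ0 (j : Fin ν) : γ (Pi.single j 1) ≠ 0 := fun h0 =>
    hg.apply_one_ne_zero (m := Pi.single j 1) (i := j) (by simp) (by rw [hγ, h0, C_0])
  set a := γ (Pi.single i 1 + r) / γ (Pi.single i 1) with ha
  obtain ⟨b, hb⟩ : ∃ b, g r (X i) - C a * X i = C b := by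
    refine eq_C_of_translate_eq fun j => ?_
    rw [map_sub, map_mul, translate_C, translate_X]
    have hj := h (Pi.single j 1)
    by_cases hij : i = j
    · subst hij
      have h1 : γ (Pi.single i 1 + r) = γ (Pi.single i 1) * a := by
        rw [ha, mul_div_cancel₀ _ (hγ0 i)]
      rw [h1, C_mul, Pi.single_eq_same, Int.cast_one, C_1, one_mul] at hj
      have h2 := mul_left_cancel₀ (by simpa using hγ0 i) hj
      rw [Pi.single_eq_same, Int.cast_one, C_1]
      linear_combination -h2
    · rw [Pi.single_eq_of_ne hij, Int.cast_zero, C_0, zero_mul] at hj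
      have h2 := (mul_eq_zero.1 hj).resolve_left (by simpa using hγ0 j)
      rw [Pi.single_eq_of_ne hij, Int.cast_zero, C_0]
      linear_combination -h2
  refine ⟨a, fun m hm => ?_⟩
  have h1 := h m
  rw [sub_eq_iff_eq_add.1 hb, map_add, map_mul, translate_C, translate_C, translate_X] at h1
  rw [hγ, hγ]
  refine mul_left_cancel₀ (a := C (m i : ℂ)) (by simpa using hm) ?_
  linear_combination -h1

end IsSymbolFamily

/-- A nowhere vanishing function on `ℤ^ν` for which `γ (m + r) / γ m` does not depend on `m`, as
long as `m` has a non-zero `i`-th coordinate, is a multiple of a character. -/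
theorem mul_eq_of_ratio {γ : (Fin ν → ℤ) → ℂ} (h0 : ∀ m, γ m ≠ 0) {a : (Fin ν → ℤ) → Fin ν → ℂ}
    (h : ∀ m r i, m i ≠ 0 → γ (m + r) = a r i * γ m) (m r : Fin ν → ℤ) :
    γ (m + r) * γ 0 = γ m * γ r := by
  have hA (r : Fin ν → ℤ) (i : Fin ν) (hr : r i ≠ 0) :
      γ r * γ (-r) = γ 0 * γ 0 ∧ a r i * γ 0 = γ r := by
    have e1 := h (-r) r i (by simpa using hr)
    have e2 := h r r i hr
    have e3 := h (r + r) r i (by simpa using hr)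
    have e4 := h (-r) (r + r) i (by simpa using hr)
    have e5 := h r (r + r) i hr
    rw [neg_add_cancel] at e1
    rw [neg_add_cancel_left] at e4
    rw [← add_assoc, e3, e2] at e5
    -- the ratios of `r` and `2r` satisfy `a_{2r} = a_r ^ 2`
    have e6 : a (r + r) i = a r i * a r i := mul_right_cancel₀ (h0 r) (by rw [← e5, mul_assoc])
    rw [e6] at e4
    constructor
    · rw [e4, e1]; ring
    · rw [e4, e1]; ring
  have hB (m r : Fin ν → ℤ) (i : Fin ν) (hm : m i ≠ 0) (hr : r i ≠ 0) :
      γ (m + r) * γ 0 = γ m * γ r := by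
    rw [h m r i hm, ← (hA r i hr).2]; ring
  by_cases hr : r = 0
  · rw [hr, add_zero]
  obtain ⟨j, hj⟩ := Function.ne_iff.1 hr
  by_cases hm : m j = 0
  · have e := hB (m + r) (-r) j (by simpa [hm] using hj) (by simpa using hj)
    rw [add_neg_cancel_right] at e
    refine mul_right_cancel₀ (h0 0) ?_
    linear_combination γ (m + r) * -(hA r j hj).1 - γ r * e
  · exact hB m r j hm hj

/-- A function `γ` on `ℤ^ν` such that `γ / γ 0` is a character is determined by its values at the
vectors `e_i`. -/
theorem exists_eq_prod_zpow {γ : (Fin ν → ℤ) → ℂ} (h0 : ∀ m, γ m ≠ 0)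
    (h : ∀ m r, γ (m + r) * γ 0 = γ m * γ r) :
    ∃ Λ : Fin ν → ℂˣ, ∀ m, γ m = γ 0 * ∏ i, (Λ i : ℂ) ^ m i := by
  refine ⟨fun i => Units.mk0 (γ (Pi.single i 1) / γ 0) (div_ne_zero (h0 _) (h0 _)), fun m => ?_⟩
  have hm : m ∈ AddSubgroup.closure (Set.range fun i : Fin ν => (Pi.single i 1 : Fin ν → ℤ)) := by
    rw [closure_single_one]; trivial
  induction hm using AddSubgroup.closure_induction with
  | mem x hx =>
    obtain ⟨i, rfl⟩ := hx
    beta_reduce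
    rw [Finset.prod_eq_single i (fun j _ hj => by rw [Pi.single_eq_of_ne hj, zpow_zero]) (by simp),
      Pi.single_eq_same, zpow_one, Units.val_mk0, mul_div_cancel₀ _ (h0 0)]
  | zero => simp
  | add x y _ _ hx hy =>
    refine mul_right_cancel₀ (h0 0) ?_
    rw [h, hx, hy, prod_zpow_add]
    ring
  | neg x _ hx =>
    have h1 := h x (-x)
    rw [add_neg_cancel] at h1
    refine mul_left_cancel₀ (h0 x) ?_
    rw [← h1, hx]
    have h2 := prod_zpow_add (fun i => Units.mk0 (γ (Pi.single i 1) / γ 0)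
      (div_ne_zero (h0 _) (h0 _))) x (-x)
    simp only [add_neg_cancel, Pi.zero_apply, zpow_zero, Finset.prod_const_one] at h2
    linear_combination γ 0 * γ 0 * h2

/-! ### Classification of symbol families -/

namespace IsSymbolFamily

variable {g : (Fin ν → ℤ) → MvPolynomial (Fin ν) ℂ →ₗ[ℂ] MvPolynomial (Fin ν) ℂ}

theorem smul_inv_prod_zpow (hg : IsSymbolFamily g) (Λ : Fin ν → ℂˣ) :
    IsSymbolFamily fun m => (∏ i, (Λ i : ℂ) ^ m i)⁻¹ • g m where
  zero_X i := by simp [hg.zero_X]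
  bracket m r p q := by
    simp only [LinearMap.smul_apply, ← hg.bracket, prod_zpow_add, smul_eq_C_mul, mul_inv,
      C_mul, map_mul (translate _), translate_C]
    ring

variable {c : ℂ}

theorem mul_apply_translate_sub (hg : IsSymbolFamily g) (hc : ∀ m, g m 1 = C c) (m : Fin ν → ℤ)
    (p q : MvPolynomial (Fin ν) ℂ) :
    C c * g m ((translate (-m) p - p) * q) = g m q * g m (translate (-m) p - p) := by
  have h1 := hg.bracket 0 m p q
  have h2 := hg.bracket 0 m p 1
  rw [neg_zero, zero_add, translate_zero, translate_zero] at h1 h2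
  rw [hc, mul_one, one_mul] at h2
  rw [← h2, sub_mul, mul_comm p q, ← h1]
  ring

/-- For `m ≠ 0`, `p ↦ g(m, p)` is multiplicative up to the scalar `c`. By the commutators with
`p(D)`, this holds when one factor is of the form `p(x + m) - p(x)`; the polynomials `x_i x_j` give
enough such factors. -/
theorem mul_apply_mul (hg : IsSymbolFamily g) (hc0 : c ≠ 0) (hc : ∀ m, g m 1 = C c)
    {m : Fin ν → ℤ} {i : Fin ν} (hm : m i ≠ 0) (p q : MvPolynomial (Fin ν) ℂ) :
    C c * g m (p * q) = g m q * g m p := by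
  have hC0 : (C c : MvPolynomial (Fin ν) ℂ) ≠ 0 := by simpa using hc0
  have hlin (a b : ℂ) (p q : MvPolynomial (Fin ν) ℂ) :
      C c * g m ((C a * p + C b) * q) - g m q * g m (C a * p + C b) =
        C a * (C c * g m (p * q) - g m q * g m p) := by
    rw [add_mul, mul_assoc, map_add, map_add, map_C_mul, map_C_mul, map_C_mul, map_C, hc]
    ring
  have hdelta (j : Fin ν) : translate (-m) (X i * X j) - X i * X j =
      C (m i : ℂ) * X j + C (m j : ℂ) * X i + C (m i * m j : ℂ) := by
    rw [map_mul, translate_X, translate_X, Pi.neg_apply, Pi.neg_apply, Int.cast_neg, Int.cast_neg,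
      C_neg, C_neg, C_mul]
    ring
  have hX (j : Fin ν) (q : MvPolynomial (Fin ν) ℂ) :
      C c * g m (X j * q) = g m q * g m (X j) := by
    have hi (q : MvPolynomial (Fin ν) ℂ) : C c * g m (X i * q) = g m q * g m (X i) := by
      have h := hg.mul_apply_translate_sub hc m (X i * X i) q
      rw [hdelta, ← add_mul, ← C_add, ← sub_eq_zero, hlin] at h
      exact sub_eq_zero.1 ((mul_eq_zero.1 h).resolve_left (by simpa using hm))
    have h := hg.mul_apply_translate_sub hc m (X i * X j) q
    rw [hdelta, add_assoc, add_mul, map_add, map_add] at h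
    have h1 := hlin (m j) (m i * m j) (X i) q
    rw [hi, sub_self, mul_zero] at h1
    refine mul_left_cancel₀ (a := C (m i : ℂ)) (by simpa using hm) ?_
    rw [mul_assoc, map_C_mul, map_C_mul] at h
    linear_combination h - h1
  induction p using MvPolynomial.induction_on generalizing q with
  | C a => rw [map_C_mul, map_C, hc]; ring
  | add p₁ p₂ h₁ h₂ => rw [add_mul, map_add, map_add, mul_add, h₁, h₂, mul_add]
  | mul_X p j hp =>
    refine mul_left_cancel₀ hC0 ?_
    have h1 := hp (X j * q)
    have h2 := hp (X j)
    rw [← mul_assoc] at h1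
    linear_combination C c * h1 + g m p * hX j q - g m q * h2

/-- `g(m, D_i) = x_i + b`. -/
theorem exists_apply_X (hg : IsSymbolFamily g) (hc0 : c ≠ 0) (hc : ∀ m, g m 1 = C c)
    (m : Fin ν → ℤ) (i : Fin ν) : ∃ b, g m (X i) = X i + C b := by
  have hC0 : (C c : MvPolynomial (Fin ν) ℂ) ≠ 0 := by simpa using hc0
  obtain ⟨b, hb⟩ : ∃ b, g m (X i) - X i = C b := by
    refine eq_C_of_translate_eq fun j => mul_left_cancel₀ hC0 ?_
    have h := hg.bracket_one_X (Pi.single j 1) m i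
    rw [hc, hc, translate_C] at h
    rw [map_sub, translate_X]
    linear_combination h
  exact ⟨b, by rw [← hb]; ring⟩

/-- The scalar `c` is `2α - 1` with `α ∈ {0, 1}`, and `g(m, D_i) = x_i - α m_i`. -/
theorem exists_apply_X_eq (hg : IsSymbolFamily g) (hν : 0 < ν) (hc0 : c ≠ 0)
    (hc : ∀ m, g m 1 = C c) :
    ∃ α : ℂ, (α = 0 ∨ α = 1) ∧ c = 2 * α - 1 ∧
      ∀ (m : Fin ν → ℤ) i, g m (X i) = X i - C (α * m i) := by
  have hC0 : (C c : MvPolynomial (Fin ν) ℂ) ≠ 0 := by simpa using hc0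
  choose b hb using hg.exists_apply_X hc0 hc
  have hb0 (i : Fin ν) : b 0 i = 0 := by
    have h := hb 0 i
    rw [hg.zero_X] at h
    simpa using h
  -- the commutators `[t^m D_i, t^r D_j]`
  have h1 (m r : Fin ν → ℤ) (i j : Fin ν) :
      r i * (b (m + r) j - b r j) = m j * (b (m + r) i - b m i) := by
    have h := hg.bracket m r (X i) (X j)
    have h' : translate (-r) (X i) * X j - translate (-m) (X j) * X i =
        (C (r i : ℂ) * X j - C (m j : ℂ) * X i : MvPolynomial (Fin ν) ℂ) := by
      simp only [translate_X, Pi.neg_apply, Int.cast_neg, C_neg]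
      ring
    rw [h', map_sub, map_C_mul, map_C_mul, hb, hb, hb, hb, map_add, map_add, translate_X,
      translate_X, translate_C, translate_C] at h
    refine C_injective (Fin ν) ℂ ?_
    simp only [C_mul, C_sub]
    linear_combination -h
  have hodd (m : Fin ν → ℤ) (i : Fin ν) (hm : m i ≠ 0) : b (-m) i = -b m i := by
    have h := h1 (-m) m i i
    rw [neg_add_cancel, hb0, Pi.neg_apply] at h
    refine mul_left_cancel₀ (a := (m i : ℂ)) (by exact_mod_cast hm) ?_
    push_cast at h
    linear_combination -h
  -- the commutator `[t^{-m} D_i^2, t^{2m}]`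
  have h2 (m : Fin ν → ℤ) (i : Fin ν) (hm : m i ≠ 0) : b m i = -((1 + c) / 2 * m i) := by
    have hm' : (-m) i ≠ 0 := by simpa using hm
    have h := hg.bracket (-m) (m + m) (X i * X i) 1
    have h' : translate (-(m + m)) (X i * X i) * 1 - translate (- -m) 1 * (X i * X i) =
        (C (4 * m i : ℂ) * X i + C (4 * m i ^ 2 : ℂ) : MvPolynomial (Fin ν) ℂ) := by
      have h4 : (C 4 : MvPolynomial (Fin ν) ℂ) = 4 := rfl
      simp only [map_mul, map_one, translate_X, Pi.neg_apply, Pi.add_apply, Int.cast_neg,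
        Int.cast_add, C_neg, C_add, C_pow, h4]
      ring
    have h3 := hg.mul_apply_mul hc0 hc hm' (X i) (X i)
    have h4 := congrArg (translate (m + m)) h3
    rw [h', neg_add_cancel_left, map_add, map_C_mul, map_C, hc, hc, hb, translate_C] at h
    rw [hb] at h3 h4
    rw [map_mul, map_mul (translate _) (X i + _), map_add, translate_C, translate_C,
      translate_X] at h4
    have h5 : (C (4 * m i * (b (-m) i - b m i - (1 + c) * m i)) : MvPolynomial (Fin ν) ℂ) =
        C 0 := by
      have h6 : (C 4 : MvPolynomial (Fin ν) ℂ) = 4 := rfl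
      simp only [C_mul, C_sub, C_add, C_1, C_0, C_pow, h6, Pi.add_apply, Int.cast_add] at h h4 ⊢
      linear_combination h - h3 + h4
    have h6 := C_injective _ _ h5
    have h7 := (mul_eq_zero.1 h6).resolve_left (by simpa using hm)
    rw [hodd m i hm] at h7
    linear_combination -h7 / 2
  have h3 (m : Fin ν → ℤ) (i : Fin ν) : b m i = -((1 + c) / 2 * m i) := by
    by_cases hm : m i = 0
    · by_cases hm0 : m = 0
      · rw [hm0, hb0]; simp
      · obtain ⟨j, hj⟩ := Function.ne_iff.1 hm0
        have h := h1 m (-m) i j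
        rw [add_neg_cancel, hb0, hb0, Pi.neg_apply, hm] at h
        have hj' : (m j : ℂ) ≠ 0 := by exact_mod_cast hj
        have h' : (m j : ℂ) * b m i = 0 := by
          simp at h ⊢
          tauto
        rw [(mul_eq_zero.1 h').resolve_left hj', hm]
        simp
    · exact h2 m i hm
  obtain ⟨α, hα⟩ : ∃ α, α = (1 + c) / 2 := ⟨_, rfl⟩
  have hcα : c = 2 * α - 1 := by rw [hα]; ring
  rw [← hα] at h3
  refine ⟨α, ?_, hcα, fun m i => by rw [hb, h3, C_neg, ← sub_eq_add_neg]⟩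
  -- the commutator `[t_i D_i^2, t_i D_i]` gives `α^2 = α`
  obtain ⟨i⟩ : Nonempty (Fin ν) := ⟨⟨0, hν⟩⟩
  set e : Fin ν → ℤ := Pi.single i 1 with he
  have hei : e i = 1 := Pi.single_eq_same ..
  have heei : (e + e) i = 2 := by rw [Pi.add_apply, hei]; rfl
  have h := hg.bracket e e (X i * X i) (X i)
  have h' : translate (-e) (X i * X i) * X i - translate (-e) (X i) * (X i * X i) =
      (X i * X i + X i : MvPolynomial (Fin ν) ℂ) := by
    rw [map_mul, translate_X, Pi.neg_apply, hei]
    simp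
    ring
  have h4 := hg.mul_apply_mul hc0 hc (m := e) (i := i) (by rw [hei]; decide) (X i) (X i)
  have h5 := hg.mul_apply_mul hc0 hc (m := e + e) (i := i) (by rw [heei]; decide) (X i) (X i)
  have h6 := congrArg (translate e) h4
  rw [h', map_add] at h
  simp only [map_mul, hb, h3, map_add, translate_C, translate_X, hei, heei] at h h4 h5 h6
  have h7 : (C (α * (α - 1)) : MvPolynomial (Fin ν) ℂ) = C 0 := by
    have h8 : (C 2 : MvPolynomial (Fin ν) ℂ) = 2 := rfl
    have hcC : (C c : MvPolynomial (Fin ν) ℂ) = 2 * C α - 1 := by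
      rw [hcα, C_sub, C_mul, h8, C_1]
    simp only [Int.cast_one, Int.cast_ofNat, mul_one, C_mul, C_sub, C_1, C_0, C_neg, h8]
      at h h4 h5 h6 ⊢
    linear_combination C c * h - (X i - 1 - C α) * h4 + (X i - C α) * h6 + h5 +
      (X i - 2 * C α) * hcC
  have h8 := C_injective _ _ h7
  rcases mul_eq_zero.1 h8 with h9 | h9
  · exact Or.inl h9
  · exact Or.inr (sub_eq_zero.1 h9)

theorem apply_eq_of_apply_X (hg : IsSymbolFamily g) (hc0 : c ≠ 0) (hc : ∀ m, g m 1 = C c)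
    {m : Fin ν → ℤ} (hm : m ≠ 0) (ψ : MvPolynomial (Fin ν) ℂ →ₐ[ℂ] MvPolynomial (Fin ν) ℂ)
    (hψ : ∀ i, g m (X i) = C c * ψ (X i)) (p : MvPolynomial (Fin ν) ℂ) :
    g m p = C c * ψ p := by
  obtain ⟨i, hi⟩ := Function.ne_iff.1 hm
  induction p using MvPolynomial.induction_on with
  | C a =>
    rw [map_C, hc, mul_comm, ← algebraMap_eq, AlgHom.commutes]
  | add p q hp hq => rw [map_add, map_add, hp, hq, mul_add]
  | mul_X p j hp =>
    refine mul_left_cancel₀ (a := C c) (by simpa using hc0) ?_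
    rw [hg.mul_apply_mul hc0 hc hi, hψ, hp, map_mul]
    ring

theorem eq_translate_or_eq_negVar (hg : IsSymbolFamily g) (hν : 0 < ν) (hc0 : c ≠ 0)
    (hc : ∀ m, g m 1 = C c) :
    (∀ m p, g m p = translate m p) ∨ ∀ m p, g m p = -negVar ν p := by
  obtain ⟨i⟩ : Nonempty (Fin ν) := ⟨⟨0, hν⟩⟩
  set e : Fin ν → ℤ := Pi.single i 1
  have he : e ≠ 0 := by simp [e]
  -- the commutator `[t_i⁻¹ p(D), t_i] = p(D + 1) - p(D)`, with the shift in the `i`-th variable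
  have h0 (p : MvPolynomial (Fin ν) ℂ) :
      C c * g (-e) p - translate e (g (-e) p) * C c = g 0 (translate (-e) p - p) := by
    have h := hg.bracket (-e) e p 1
    rwa [hc, translate_C, neg_add_cancel, mul_one, map_one, one_mul] at h
  obtain ⟨α, hα, hcα, hX⟩ := hg.exists_apply_X_eq hν hc0 hc
  rcases hα with rfl | rfl
  · right
    have hcC : (C c : MvPolynomial (Fin ν) ℂ) = -1 := by rw [hcα]; simp
    have h1 (m : Fin ν → ℤ) (hm : m ≠ 0) (p : MvPolynomial (Fin ν) ℂ) : g m p = -negVar ν p := by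
      rw [hg.apply_eq_of_apply_X hc0 hc hm (negVar ν), hcC, neg_one_mul]
      intro j
      rw [hX, hcC]
      simp [negVar]
    intro m q
    by_cases hm : m = 0
    · subst hm
      obtain ⟨p, rfl⟩ := exists_translate_sub_eq i q
      rw [← h0, h1 _ (neg_ne_zero.2 he), hcC, map_sub, negVar_translate, map_neg]
      ring
    · exact h1 m hm q
  · left
    have hcC : (C c : MvPolynomial (Fin ν) ℂ) = 1 := by
      rw [hcα, ← C_1]
      congr 1
      norm_num
    have h1 (m : Fin ν → ℤ) (hm : m ≠ 0) (p : MvPolynomial (Fin ν) ℂ) :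
        g m p = translate m p := by
      rw [hg.apply_eq_of_apply_X hc0 hc hm (translate m), hcC, one_mul]
      intro j
      rw [hX, hcC, one_mul, one_mul, translate_X]
    intro m q
    by_cases hm : m = 0
    · subst hm
      obtain ⟨p, rfl⟩ := exists_translate_sub_eq i q
      rw [← h0, h1 _ (neg_ne_zero.2 he), hcC, translate_translate_neg, translate_zero]
      ring
    · exact h1 m hm q

/-- The symbol families are those of the modules `Ω(Λ, 1)` and `Ω(Λ, 0)`. -/
theorem exists_eq_smul (hg : IsSymbolFamily g) (hν : 0 < ν) :
    ∃ Λ : Fin ν → ℂˣ, (∀ m p, g m p = (∏ i, (Λ i : ℂ) ^ m i) • translate m p) ∨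
      ∀ m p, g m p = -((∏ i, (Λ i : ℂ) ^ m i) • negVar ν p) := by
  choose γ hγ using hg.exists_apply_one
  have h0 (m : Fin ν → ℤ) : γ m ≠ 0 := by
    intro h
    have h1 : g m 1 = 0 := by rw [hγ, h, C_0]
    by_cases hm : m = 0
    · exact (hg.exists_apply_single_one ⟨0, hν⟩).1 (hm ▸ h1)
    · obtain ⟨i, hi⟩ := Function.ne_iff.1 hm
      exact hg.apply_one_ne_zero hi h1
  choose a ha using hg.apply_one_add
  have hratio (m r : Fin ν → ℤ) (i : Fin ν) (hm : m i ≠ 0) : γ (m + r) = a r i * γ m := by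
    refine C_injective (Fin ν) ℂ ?_
    rw [← hγ, ha r i m hm, hγ, C_mul]
  obtain ⟨Λ, hΛ⟩ := exists_eq_prod_zpow h0 (mul_eq_of_ratio h0 hratio)
  have hΛ0 (m : Fin ν → ℤ) : ∏ i, (Λ i : ℂ) ^ m i ≠ 0 := fun h => h0 m (by rw [hΛ, h, mul_zero])
  have hc (m : Fin ν → ℤ) : ((∏ i, (Λ i : ℂ) ^ m i)⁻¹ • g m) 1 = C (γ 0) := by
    rw [LinearMap.smul_apply, hγ, smul_eq_C_mul, ← C_mul, hΛ m, mul_comm,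
      mul_inv_cancel_right₀ (hΛ0 m)]
  refine ⟨Λ, ((hg.smul_inv_prod_zpow Λ).eq_translate_or_eq_negVar hν (h0 0) hc).imp
    (fun h m p => ?_) fun h m p => ?_⟩
  · rw [← h, LinearMap.smul_apply, smul_inv_smul₀ (hΛ0 m)]
  · rw [← smul_neg, ← h, LinearMap.smul_apply, smul_inv_smul₀ (hΛ0 m)]

end IsSymbolFamily

/-! ### The enveloping algebra of the Cartan subalgebra -/

theorem tp_zero_X (i : Fin ν) : tp 0 (X i) = eulerD i := by
  refine Subtype.ext (end_ext fun k => ?_)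
  change symOp 0 (X i) (tpow k) = euler i (tpow k)
  rw [symOp_tpow, euler_tpow]
  simp [pt]

/-- `D_i` as an element of `𝔥_ν`. -/
def cartanD (i : Fin ν) : cartan ν := ⟨eulerD i, Submodule.subset_span ⟨i, rfl⟩⟩

theorem cartan_induction {P : cartan ν → Prop} (zero : P 0) (add : ∀ x y, P x → P y → P (x + y))
    (smul : ∀ (c : ℂ) x, P x → P (c • x)) (mem : ∀ i, P (cartanD i)) (x : cartan ν) : P x := by
  obtain ⟨x, hx⟩ := x
  induction hx using Submodule.span_induction with
  | mem x h => obtain ⟨i, rfl⟩ := h; exact mem i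
  | zero => exact zero
  | add x y _ _ hx hy => exact add _ _ hx hy
  | smul c x _ hx => exact smul c _ hx

theorem cartan_lie (x y : cartan ν) : ⁅x, y⁆ = 0 := by
  induction x using cartan_induction with
  | zero => rw [zero_lie]
  | add a b ha hb => rw [add_lie, ha, hb, add_zero]
  | smul c a ha => rw [smul_lie, ha, smul_zero]
  | mem i =>
    induction y using cartan_induction with
    | zero => rw [lie_zero]
    | add a b ha hb => rw [lie_add, ha, hb, add_zero]
    | smul c a ha => rw [lie_smul, ha, smul_zero]
    | mem j => exact Subtype.ext (eulerD_lie i j)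

/-- The Lie homomorphism `𝔥_ν → ℂ[x₁, …, x_ν]`, `D_i ↦ x_i`: the symbol of the weight zero part. -/
def cartanSymbol (ν : ℕ) : cartan ν →ₗ⁅ℂ⁆ MvPolynomial (Fin ν) ℂ :=
  { (Finsupp.lapply 0 ∘ₗ (symbEquiv ν).symm.toLinearMap) ∘ₗ
      ((cartan ν).incl : cartan ν →ₗ[ℂ] DiffLie ν) with
    map_lie' := by
      intro x y
      rw [cartan_lie, LieRing.of_associative_ring_bracket, mul_comm, sub_self]
      exact LinearMap.map_zero _ }

theorem cartanSymbol_cartanD (i : Fin ν) : cartanSymbol ν (cartanD i) = X i := by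
  change (symbEquiv ν).symm (eulerD i) 0 = X i
  have h : eulerD i = symbEquiv ν (Finsupp.single 0 (X i)) := by
    rw [symbEquiv_single, ← tp_zero_X]
    rfl
  rw [h, LinearEquiv.symm_apply_apply, Finsupp.single_eq_same]

theorem adjoin_range_ι (L : Type*) [LieRing L] [LieAlgebra ℂ L] :
    Algebra.adjoin ℂ (Set.range (UniversalEnvelopingAlgebra.ι ℂ : L → _)) = ⊤ := by
  set S := Algebra.adjoin ℂ (Set.range (UniversalEnvelopingAlgebra.ι ℂ : L → _))
  let f : L →ₗ⁅ℂ⁆ S :=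
    { toFun := fun x => ⟨UniversalEnvelopingAlgebra.ι ℂ x, Algebra.subset_adjoin ⟨x, rfl⟩⟩
      map_add' := fun x y => Subtype.ext (map_add _ x y)
      map_smul' := fun c x => Subtype.ext (map_smul _ c x)
      map_lie' := fun {x y} => Subtype.ext (LieHom.map_lie _ x y) }
  have h : S.val.comp (UniversalEnvelopingAlgebra.lift ℂ f) = AlgHom.id ℂ _ := by
    refine UniversalEnvelopingAlgebra.hom_ext ℂ (LieHom.ext fun x => ?_)
    change S.val (UniversalEnvelopingAlgebra.lift ℂ f (UniversalEnvelopingAlgebra.ι ℂ x)) =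
      UniversalEnvelopingAlgebra.ι ℂ x
    rw [UniversalEnvelopingAlgebra.lift_ι_apply]
    rfl
  refine (Algebra.eq_top_iff).2 fun x => ?_
  have hx := DFunLike.congr_fun h x
  rw [AlgHom.id_apply] at hx
  rw [← hx]
  exact (UniversalEnvelopingAlgebra.lift ℂ f x).2

theorem envelopingAlgebra_cartan_mul_comm (a b : UniversalEnvelopingAlgebra ℂ (cartan ν)) :
    a * b = b * a := by
  have hι (x y : cartan ν) : Commute (UniversalEnvelopingAlgebra.ι ℂ x)
      (UniversalEnvelopingAlgebra.ι ℂ y) := by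
    have h := LieHom.map_lie (UniversalEnvelopingAlgebra.ι ℂ) x y
    rw [cartan_lie, map_zero, LieRing.of_associative_ring_bracket] at h
    exact sub_eq_zero.1 h.symm
  have hmem (x : UniversalEnvelopingAlgebra ℂ (cartan ν)) : x ∈ Algebra.adjoin ℂ
      (Set.range (UniversalEnvelopingAlgebra.ι ℂ : cartan ν → _)) := by
    rw [adjoin_range_ι]; trivial
  refine Algebra.commute_of_mem_adjoin_of_forall_mem_commute (hmem b) ?_
  rintro _ ⟨y, rfl⟩
  refine (Algebra.commute_of_mem_adjoin_of_forall_mem_commute (hmem a) ?_).symm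
  rintro _ ⟨x, rfl⟩
  exact hι y x

/-- `U(𝔥_ν)` is the polynomial algebra in `D₁, …, D_ν`. -/
theorem lift_cartanSymbol_bijective :
    Function.Bijective (UniversalEnvelopingAlgebra.lift ℂ (cartanSymbol ν)) := by
  let _ : CommRing (UniversalEnvelopingAlgebra ℂ (cartan ν)) :=
    { (inferInstance : Ring (UniversalEnvelopingAlgebra ℂ (cartan ν))) with
      mul_comm := envelopingAlgebra_cartan_mul_comm }
  let φ : MvPolynomial (Fin ν) ℂ →ₐ[ℂ] UniversalEnvelopingAlgebra ℂ (cartan ν) :=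
    aeval fun i => UniversalEnvelopingAlgebra.ι ℂ (cartanD i)
  have hφ (i : Fin ν) : φ (X i) = UniversalEnvelopingAlgebra.ι ℂ (cartanD i) := aeval_X _ i
  refine Function.bijective_iff_has_inverse.2 ⟨φ, fun x => ?_, fun p => ?_⟩
  · have h : φ.comp (UniversalEnvelopingAlgebra.lift ℂ (cartanSymbol ν)) = AlgHom.id ℂ _ := by
      refine UniversalEnvelopingAlgebra.hom_ext ℂ (LieHom.ext fun x => ?_)
      change φ (UniversalEnvelopingAlgebra.lift ℂ (cartanSymbol ν)
        (UniversalEnvelopingAlgebra.ι ℂ x)) = UniversalEnvelopingAlgebra.ι ℂ x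
      rw [UniversalEnvelopingAlgebra.lift_ι_apply]
      induction x using cartan_induction with
      | zero => simp only [map_zero]
      | add a b ha hb => simp only [map_add, ha, hb]
      | smul c a ha => simp only [map_smul, ha]
      | mem i => rw [cartanSymbol_cartanD, hφ]
    exact DFunLike.congr_fun h x
  · have h : (UniversalEnvelopingAlgebra.lift ℂ (cartanSymbol ν)).comp φ = AlgHom.id ℂ _ := by
      refine MvPolynomial.algHom_ext fun i => ?_
      rw [AlgHom.comp_apply, hφ, UniversalEnvelopingAlgebra.lift_ι_apply, cartanSymbol_cartanD,
        AlgHom.id_apply]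
    exact DFunLike.congr_fun h p

/-! ### Modules that are free of rank one over `U(𝔥_ν)` -/

section Module

variable {M : Type*} [AddCommGroup M] [Module ℂ M] [LieRingModule (DiffLie ν) M]
  [LieModule ℂ (DiffLie ν) M]

theorem exists_equiv_mvPolynomial (hM : IsFreeOfRankOne (cartan ν) M) :
    ∃ Φ : M ≃ₗ[ℂ] MvPolynomial (Fin ν) ℂ, ∀ i x, Φ ⁅(eulerD i : DiffLie ν), x⁆ = X i * Φ x := by
  let _ := envelopingModule (cartan ν) M
  obtain ⟨e⟩ := hM
  let σ := UniversalEnvelopingAlgebra.lift ℂ (cartanSymbol ν)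
  have hsmul (u : UniversalEnvelopingAlgebra ℂ (cartan ν)) (x : M) :
      u • x = UniversalEnvelopingAlgebra.lift ℂ (LieModule.toEnd ℂ (cartan ν) M) u x := rfl
  let Ψ : M →ₗ[ℂ] MvPolynomial (Fin ν) ℂ :=
    { toFun := fun x => σ (e x)
      map_add' := fun x y => by rw [map_add, map_add]
      map_smul' := fun c x => by
        have h : c • x = algebraMap ℂ (UniversalEnvelopingAlgebra ℂ (cartan ν)) c • x := by
          rw [hsmul, AlgHom.commutes, Module.algebraMap_end_apply]
        rw [h, map_smul, smul_eq_mul, map_mul, AlgHom.commutes, ← Algebra.smul_def,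
          RingHom.id_apply] }
  refine ⟨LinearEquiv.ofBijective Ψ (lift_cartanSymbol_bijective.comp e.bijective), fun i x => ?_⟩
  have h : ⁅(eulerD i : DiffLie ν), x⁆ = UniversalEnvelopingAlgebra.ι ℂ (cartanD i) • x := by
    rw [hsmul, UniversalEnvelopingAlgebra.lift_ι_apply]
    rfl
  change σ (e _) = X i * σ (e x)
  rw [h, map_smul, smul_eq_mul, map_mul, UniversalEnvelopingAlgebra.lift_ι_apply,
    cartanSymbol_cartanD]

/-- The operator on `ℂ[x₁, …, x_ν]` that corresponds to the action of an element of `𝒟_ν` on `M`. -/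
def transportOp (Φ : M ≃ₗ[ℂ] MvPolynomial (Fin ν) ℂ) :
    DiffLie ν →ₗ[ℂ] Module.End ℂ (MvPolynomial (Fin ν) ℂ) :=
  Φ.conj.toLinearMap ∘ₗ (LieModule.toEnd ℂ (DiffLie ν) M : DiffLie ν →ₗ[ℂ] Module.End ℂ M)

theorem transportOp_apply (Φ : M ≃ₗ[ℂ] MvPolynomial (Fin ν) ℂ) (a : DiffLie ν)
    (f : MvPolynomial (Fin ν) ℂ) : transportOp Φ a f = Φ ⁅a, Φ.symm f⁆ := rfl

theorem transportOp_lie (Φ : M ≃ₗ[ℂ] MvPolynomial (Fin ν) ℂ) (a b : DiffLie ν)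
    (f : MvPolynomial (Fin ν) ℂ) :
    transportOp Φ ⁅a, b⁆ f =
      transportOp Φ a (transportOp Φ b f) - transportOp Φ b (transportOp Φ a f) := by
  simp only [transportOp_apply, LinearEquiv.symm_apply_apply, lie_lie, map_sub]

/-- `t^m p(D)` shifts the weights of `𝔥_ν` by `m`, so that its action is determined by the image
of `1`. -/
theorem transportOp_tp (Φ : M ≃ₗ[ℂ] MvPolynomial (Fin ν) ℂ)
    (hΦ : ∀ i x, Φ ⁅(eulerD i : DiffLie ν), x⁆ = X i * Φ x) (m : Fin ν → ℤ)
    (p f : MvPolynomial (Fin ν) ℂ) :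
    transportOp Φ (tp m p) f = translate m f * transportOp Φ (tp m p) 1 := by
  have hD (i : Fin ν) (f : MvPolynomial (Fin ν) ℂ) : transportOp Φ (tp 0 (X i)) f = X i * f := by
    rw [tp_zero_X, transportOp_apply, hΦ, LinearEquiv.apply_symm_apply]
  have hbr (i : Fin ν) : ⁅tp 0 (X i), tp m p⁆ = (m i : ℂ) • tp m p := by
    rw [tp_lie]
    refine Subtype.ext ?_
    change symOp _ _ - symOp _ _ = (m i : ℂ) • symOp m p
    rw [zero_add, add_zero, neg_zero, translate_zero, ← map_sub, ← map_smul, translate_X,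
      smul_eq_C_mul, Pi.neg_apply, Int.cast_neg, C_neg]
    congr 1
    ring
  induction f using MvPolynomial.induction_on with
  | C a => rw [translate_C, map_C]
  | add f₁ f₂ h₁ h₂ => rw [map_add, map_add, h₁, h₂, add_mul]
  | mul_X f i hf =>
    have h := transportOp_lie Φ (tp 0 (X i)) (tp m p) f
    rw [hbr, map_smul, LinearMap.smul_apply, hD, hD, hf, smul_eq_C_mul] at h
    rw [map_mul (translate _), translate_X, mul_comm f]
    linear_combination h

/-- The symbol family of `M`. -/
def symbolOf (Φ : M ≃ₗ[ℂ] MvPolynomial (Fin ν) ℂ) (m : Fin ν → ℤ) :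
    MvPolynomial (Fin ν) ℂ →ₗ[ℂ] MvPolynomial (Fin ν) ℂ :=
  LinearMap.applyₗ 1 ∘ₗ transportOp Φ ∘ₗ (symbEquiv ν).toLinearMap ∘ₗ Finsupp.lsingle m

theorem symbolOf_apply (Φ : M ≃ₗ[ℂ] MvPolynomial (Fin ν) ℂ) (m : Fin ν → ℤ)
    (p : MvPolynomial (Fin ν) ℂ) : symbolOf Φ m p = transportOp Φ (tp m p) 1 := by
  change transportOp Φ (symbEquiv ν (Finsupp.single m p)) 1 = _
  rw [symbEquiv_single]
  rfl

theorem isSymbolFamily_symbolOf (Φ : M ≃ₗ[ℂ] MvPolynomial (Fin ν) ℂ)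
    (hΦ : ∀ i x, Φ ⁅(eulerD i : DiffLie ν), x⁆ = X i * Φ x) : IsSymbolFamily (symbolOf Φ) where
  zero_X i := by
    rw [symbolOf_apply, tp_zero_X, transportOp_apply, hΦ, LinearEquiv.apply_symm_apply, mul_one]
  bracket m r p q := by
    rw [map_sub]
    simp only [symbolOf_apply]
    rw [← transportOp_tp Φ hΦ, ← transportOp_tp Φ hΦ, ← transportOp_lie, tp_lie, map_sub,
      LinearMap.sub_apply, add_comm r m]

theorem nonempty_equiv_omega (Φ : M ≃ₗ[ℂ] MvPolynomial (Fin ν) ℂ) {Λ : Fin ν → ℂˣ} {ε : Fin 2}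
    (h : ∀ m p f, transportOp Φ (tp m p) f = omegaMap Λ ε (tp m p) f) :
    Nonempty (M ≃ₗ⁅ℂ, DiffLie ν⁆ Omega Λ ε) := by
  have h1 (a : DiffLie ν) : transportOp Φ a = omegaMap Λ ε a := by
    induction span_tp a using Submodule.span_induction with
    | mem x hx => obtain ⟨⟨m, p⟩, rfl⟩ := hx; exact LinearMap.ext (h m p)
    | zero => rw [map_zero, map_zero]
    | add x y _ _ hx hy => rw [map_add, map_add, hx, hy]
    | smul c x _ hx => rw [map_smul, map_smul, hx]
  let Φ' : M ≃ₗ[ℂ] Omega Λ ε := Φ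
  exact ⟨{ Φ' with
    map_lie' := by
      intro a x
      change Φ ⁅a, x⁆ = omegaMap Λ ε a (Φ x)
      rw [← h1, transportOp_apply, LinearEquiv.symm_apply_apply] }⟩

end Module

end DiffOpModule

end

theorem mainTheorem4 (ν : ℕ) (hν : 0 < ν) (M : Type*) [AddCommGroup M] [Module ℂ M]
    [LieRingModule (DiffOpModule.DiffLie ν) M] [LieModule ℂ (DiffOpModule.DiffLie ν) M]
    (hM : DiffOpModule.IsFreeOfRankOne (DiffOpModule.cartan ν) M) :
    ∃ (Λ : Fin ν → ℂˣ) (ε : Fin 2),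
      Nonempty (M ≃ₗ⁅ℂ, DiffOpModule.DiffLie ν⁆ DiffOpModule.Omega Λ ε) := by
  obtain ⟨Φ, hΦ⟩ := DiffOpModule.exists_equiv_mvPolynomial hM
  obtain ⟨Λ, h | h⟩ := (DiffOpModule.isSymbolFamily_symbolOf Φ hΦ).exists_eq_smul hν
  · refine ⟨Λ, 1, DiffOpModule.nonempty_equiv_omega Φ fun m p f => ?_⟩
    rw [DiffOpModule.transportOp_tp Φ hΦ, ← DiffOpModule.symbolOf_apply, h,
      DiffOpModule.omegaMap_tp_one, map_mul, mul_smul_comm, mul_comm]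
  · refine ⟨Λ, 0, DiffOpModule.nonempty_equiv_omega Φ fun m p f => ?_⟩
    rw [DiffOpModule.transportOp_tp Φ hΦ, ← DiffOpModule.symbolOf_apply, h,
      DiffOpModule.omegaMap_tp_zero, mul_neg, mul_smul_comm, mul_comm]
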